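/- Let $k\ge 0$ be an integer and let $\Pi$ be a finite collection of predicates $P:\{0,1\}^k\to\{0,1\}$. A \emph{constraint} on $n$ variables is a function $x\mapsto P(x_{i_1},\dots,x_{i_k})$ on $\{0,1\}^n$ with $P\in\Pi$ and distinct $i_1,\dots,i_k\in[n]$. An \emph{instance} $\Im$ of $\mathrm{max}\text{-}\Pi_n$ is a nonempty finite list of constraints $P_1,\dots,P_M$ on $n$ variables; we write $\Im(x)=\frac1M\sum_{i=1}^M P_i(x)$ and $\mathrm{opt}(\Im)=\max_{x\in\{0,1\}^n}\Im(x)$. For $f:\{0,1\}^n\to\mathbb R$ let $\overline{\mathrm{sos}}_d(f)$ be the smallest $v\in\mathbb R$ such that $v-f=\sum_{j=1}^t g_j^2$ on $\{0,1\}^n$ for some $t$ and some functions $g_j:\{0,1\}^n\to\mathbb R$ of degree at most $d/2$ (as multilinear polynomials), with $\overline{\mathrm{sos}}_d(f)=\infty$ if there is no such $v$. The \emph{degree-$d$ sos relaxation achieves a $(c,s)$-approximation for $\mathrm{max}\text{-}\Pi_n$} if $\overline{\mathrm{sos}}_d(\Im)\le c$ for every instance $\Im$ of $\mathrm{max}\text{-}\Pi_n$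 with $\mathrm{opt}(\Im)\le s$. An \emph{SDP relaxation of size $r$ for $\mathrm{max}\text{-}\Pi_n$} consists of matrices $\tilde\Im\in\mathbb R^{r\times r}$ for all instances $\Im$ of $\mathrm{max}\text{-}\Pi_n$ and $\tilde x\in\mathbb R^{r\times r}$ for all $x\in\{0,1\}^n$ with $\langle\tilde\Im,\tilde x\rangle=\mathrm{Tr}(\tilde\Im^{T}\tilde x)=\Im(x)$, and a spectrahedron $\mathcal S=\{y\in\mathbb R^{r\times r}: y\succeq 0,\ Ay=b\}$, where $A$ is a linear map and $b$ a vector (both independent of $\Im$), such that $\tilde x\in\mathcal S$ for all $x$. It \emph{achieves a $(c,s)$-approximation} if $\sup_{y\in\mathcal S}\langle\tilde\Im,y\rangle\le c$ for every instance $\Im$ of $\mathrm{max}\text{-}\Pi_n$ with $\mathrm{opt}(\Im)\le s$. **Theorem.** Let $d:\{1,2,\dots\}\to\mathbb N$ be monotone increasing (that is, nondecreasing) with $d(1)\ge 2\lceil k/2\rceil$ and $\lim_{n\to\infty}d(n)=\infty$. Let $\varepsilon>0$ and $0<s<c\le 1$. Then there is a constant $K>0$ (depending only on $\Pi,d,\varepsilon,c,s$)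 such that the following holds for every $n\ge 1$: if the degree-$d(n)$ sos relaxation does not achieve a $(c+\varepsilon,s)$-approximation for $\mathrm{max}\text{-}\Pi_n$, then for every $N>n^{4d(n)}$ no SDP relaxation of size at most $K\,n^{d(n)^2/8}$ achieves a $(c,s)$-approximation for $\mathrm{max}\text{-}\Pi_N$. -/

import Mathlib

/-- The discrete cube `{0,1}^n`. -/
abbrev Cube (n : ℕ) : Type := Fin n → Bool

/-- The real value of a bit. -/
def bitVal (b : Bool) : ℝ := if b then 1 else 0

/-- The function `f` on the cube has degree at most `e`: the multilinear polynomial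
`∑ A, a A * ∏ i ∈ A, x i` that agrees with `f` on the cube only has monomials with `|A| ≤ e`. -/
def DegreeLE {n : ℕ} (f : Cube n → ℝ) (e : ℕ) : Prop :=
  ∃ a : Finset (Fin n) → ℝ, (∀ A, e < A.card → a A = 0) ∧
    ∀ x, f x = ∑ A, a A * ∏ i ∈ A, bitVal (x i)

/-- `f` is a sum of squares of functions of degree at most `d / 2`
(degrees are integers, so the rounding in `d / 2` is harmless). -/
def IsCubeSOS {n : ℕ} (d : ℕ) (f : Cube n → ℝ) : Prop :=
  ∃ (t : ℕ) (g : Fin t → Cube n → ℝ), (∀ j, DegreeLE (g j) (d / 2)) ∧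
    ∀ x, f x = ∑ j, g j x ^ 2

/-- The degree-`d` sum-of-squares upper bound: the least `v` such that `v - f` is a sum of squares
of functions of degree at most `d / 2` (`⊤` if there is no such `v`). -/
noncomputable def sosBound {n : ℕ} (d : ℕ) (f : Cube n → ℝ) : EReal :=
  sInf {v : EReal | ∃ c : ℝ, v = (c : EReal) ∧ IsCubeSOS d (fun x => c - f x)}

/-- A `k`-ary boolean CSP: a finite collection of predicates `{0,1}^k → {0,1}`. -/
abbrev BoolCSP (k : ℕ) : Type := Finset (Cube k → Bool)

/-- A constraint over `n` variables: a predicate of the CSP applied to distinct variables. -/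
structure CSPConstraint {k : ℕ} (P : BoolCSP k) (n : ℕ) where
  pred : Cube k → Bool
  pred_mem : pred ∈ P
  vars : Fin k ↪ Fin n

/-- The `0/1` value of a constraint under an assignment. -/
def CSPConstraint.value {k n : ℕ} {P : BoolCSP k} (C : CSPConstraint P n) (x : Cube n) : ℝ :=
  bitVal (C.pred (fun j => x (C.vars j)))

/-- An instance on `n` variables: a nonempty finite family of constraints. -/
structure CSPInstance {k : ℕ} (P : BoolCSP k) (n : ℕ) where
  size : ℕ
  size_pos : 0 < size
  constraint : Fin size → CSPConstraint P n

/-- The fraction of constraints satisfied by an assignment. -/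
noncomputable def CSPInstance.value {k n : ℕ} {P : BoolCSP k} (I : CSPInstance P n)
    (x : Cube n) : ℝ :=
  (1 / (I.size : ℝ)) * ∑ j, (I.constraint j).value x

/-- The optimal value of an instance. -/
noncomputable def CSPInstance.opt {k n : ℕ} {P : BoolCSP k} (I : CSPInstance P n) : ℝ :=
  Finset.univ.sup' Finset.univ_nonempty I.value

/-- The degree-`d` sos relaxation achieves a `(c, s)`-approximation on `n`-variable instances. -/
def SosAchieves {k : ℕ} (P : BoolCSP k) (n d : ℕ) (c s : ℝ) : Prop :=
  ∀ I : CSPInstance P n, I.opt ≤ s → sosBound d I.value ≤ (c : EReal)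

/-- The trace inner product on `r × r` matrices. -/
def frobInner {r : ℕ} (A B : Matrix (Fin r) (Fin r) ℝ) : ℝ := (A.transpose * B).trace

/-- An SDP relaxation of size `r` for the `n`-variable instances of a CSP: a linearization of
instances and assignments, and a spectrahedron `{y ⪰ 0 | A y = b}` that contains the linearized
assignments and does not depend on the instance. -/
structure SDPRelaxation {k : ℕ} (P : BoolCSP k) (n r : ℕ) where
  linInstance : CSPInstance P n → Matrix (Fin r) (Fin r) ℝ
  linAssignment : Cube n → Matrix (Fin r) (Fin r) ℝ
  inner_eq : ∀ I x, frobInner (linInstance I) (linAssignment x) = I.value x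
  numEqs : ℕ
  A : Matrix (Fin r) (Fin r) ℝ →ₗ[ℝ] (Fin numEqs → ℝ)
  b : Fin numEqs → ℝ
  posSemidef_assignment : ∀ x, (linAssignment x).PosSemidef
  map_assignment : ∀ x, A (linAssignment x) = b

/-- The feasible spectrahedron of a relaxation. -/
def SDPRelaxation.feasible {k n r : ℕ} {P : BoolCSP k} (R : SDPRelaxation P n r) :
    Set (Matrix (Fin r) (Fin r) ℝ) :=
  {y | y.PosSemidef ∧ R.A y = R.b}

/-- The value of a relaxation on an instance: the supremum of the linearized objective over the
feasible region (`⊤` if unbounded). -/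
noncomputable def SDPRelaxation.value {k n r : ℕ} {P : BoolCSP k} (R : SDPRelaxation P n r)
    (I : CSPInstance P n) : EReal :=
  ⨆ y ∈ R.feasible, ((frobInner (R.linInstance I) y : ℝ) : EReal)

/-- The relaxation achieves a `(c, s)`-approximation on `n`-variable instances. -/
def SDPRelaxation.Achieves {k n r : ℕ} {P : BoolCSP k} (R : SDPRelaxation P n r)
    (c s : ℝ) : Prop :=
  ∀ I : CSPInstance P n, I.opt ≤ s → R.value I ≤ (c : EReal)

/-!
If degree-`d` sums of squares fail on an instance `I` in `n` variables, convex duality provides a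
pseudo-density `D` on the `n`-cube: it has mean one, is bounded by `(n + 1) ^ d`, pairs
nonnegatively with squares of degree at most `d / 2` functions, and yet `𝔼 D (c + ε - I) ≤ 0`.
Arrange `n * q ≤ N` of the `N` variables in `n` blocks of size `q`. Each map `S : Fin n → Fin q`
selects one variable from every block and thereby plants a copy of `I`, whose value at `x` is
`I (x|S)`. By SDP duality, a relaxation of size `r` that achieves `(c, s)` yields an approximate
factorization `c - I (x|S) ≈ tr (P S * Q x) + l S` with `r × r` positive semidefinite matrices
and `0 ≤ l S`, which can be rescaled so that `𝔼 P ≤ 1` while `tr (Q x)` remains bounded.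

Put `F x = 𝔼 S, D (x|S) • P S`, so that `-B ≤ F ≤ B` for the bound `B` of `D`. Then
`𝔼 tr (Q x * F x)` is bounded away from zero on the negative side, so a large power `R` of `B - F`
concentrates on negative eigenvalues of `F`: `𝔼 tr (R² * F) < -η * 𝔼 tr R²`. On the other hand
the entries of `R` are polynomials of some degree `l` far below `q`, and a fixed set of `l`
variables contains more than `d / 2` of the variables selected by a random `S` with probability
at most `(l / q) ^ (d / 2 + 1)`. Hence `R` has, up to a small error, degree at most `d / 2` in
the variables selected by `S`, and the pseudo-positivity of `D` bounds `𝔼 tr (R² * F)` below by a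
contradictory amount.
-/

open scoped BigOperators

section Walsh

variable {ι : Type*}

/-- The Walsh character `(-1) ^ ∑ i ∈ A, x i`, written with the signs `1 - 2 * x i`. -/
def walsh (A : Finset ι) (x : ι → Bool) : ℝ := ∏ i ∈ A, (1 - 2 * bitVal (x i))

theorem one_sub_two_mul_bitVal_mul_self (b : Bool) :
    (1 - 2 * bitVal b) * (1 - 2 * bitVal b) = 1 := by
  cases b <;> norm_num [bitVal]

theorem walsh_empty : walsh (∅ : Finset ι) = 1 := rfl

theorem walsh_mul_self (A : Finset ι) : walsh A * walsh A = 1 := by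
  ext x
  simp only [Pi.mul_apply, walsh, ← Finset.prod_mul_distrib, one_sub_two_mul_bitVal_mul_self,
    Finset.prod_const_one, Pi.one_apply]

theorem abs_walsh (A : Finset ι) (x : ι → Bool) : |walsh A x| = 1 := by
  rw [← sq_eq_sq₀ (abs_nonneg _) zero_le_one, sq_abs, one_pow, sq]
  exact congrFun (walsh_mul_self A) x

theorem walsh_union [DecidableEq ι] {A B : Finset ι} (h : Disjoint A B) :
    walsh (A ∪ B) = walsh A * walsh B :=
  funext fun _ => Finset.prod_union h

theorem walsh_mul [DecidableEq ι] (A B : Finset ι) :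
    walsh A * walsh B = walsh (symmDiff A B) := by
  have hA : walsh A = walsh (A \ B) * walsh (A ∩ B) := by
    rw [← walsh_union (Finset.disjoint_sdiff_inter A B), Finset.sdiff_union_inter]
  have hB : walsh B = walsh (B \ A) * walsh (A ∩ B) := by
    rw [Finset.inter_comm, ← walsh_union (Finset.disjoint_sdiff_inter B A),
      Finset.sdiff_union_inter]
  rw [symmDiff, Finset.sup_eq_union, walsh_union disjoint_sdiff_sdiff, hA, hB]
  linear_combination walsh (A \ B) * walsh (B \ A) * walsh_mul_self (A ∩ B)

theorem expect_walsh [Fintype ι] [DecidableEq ι] (A : Finset ι) :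
    𝔼 x, walsh A x = if A = ∅ then 1 else 0 := by
  split_ifs with hA
  · simp [hA, walsh_empty]
  · obtain ⟨i, hi⟩ := Finset.nonempty_iff_ne_empty.mpr hA
    have hprod : ∀ x : ι → Bool,
        walsh A x = ∏ j, (if j ∈ A then 1 - 2 * bitVal (x j) else 1) := fun x => by
      rw [walsh, Finset.prod_ite_mem, Finset.univ_inter]
    rw [Fintype.expect_eq_sum_div_card, Finset.sum_congr rfl fun x _ => hprod x,
      ← Fintype.prod_sum fun j b => if j ∈ A then 1 - 2 * bitVal b else 1,
      Finset.prod_eq_zero (Finset.mem_univ i) (by norm_num [hi, bitVal]), zero_div]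

theorem expect_walsh_mul_walsh [Fintype ι] [DecidableEq ι] (A B : Finset ι) :
    𝔼 x, walsh A x * walsh B x = if A = B then 1 else 0 := by
  simp_rw [← Pi.mul_apply, walsh_mul, expect_walsh]
  exact if_congr symmDiff_eq_bot rfl rfl

/-- The functions on the cube `ι → Bool` of degree at most `e`, presented through the Walsh
characters; `degreeLE_iff_mem_lowDegree` relates this to multilinear polynomials. -/
def lowDegree (ι : Type*) (e : ℕ) : Submodule ℝ ((ι → Bool) → ℝ) :=
  Submodule.span ℝ (walsh '' {A : Finset ι | A.card ≤ e})

theorem walsh_mem_lowDegree {A : Finset ι} {e : ℕ} (h : A.card ≤ e) : walsh A ∈ lowDegree ι e :=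
  Submodule.subset_span ⟨A, h, rfl⟩

theorem lowDegree_mono {e e' : ℕ} (h : e ≤ e') : lowDegree ι e ≤ lowDegree ι e' :=
  Submodule.span_mono (Set.image_mono fun _ hA => le_trans hA h)

theorem one_mem_lowDegree (e : ℕ) : (1 : (ι → Bool) → ℝ) ∈ lowDegree ι e :=
  walsh_empty (ι := ι) ▸ walsh_mem_lowDegree (Nat.zero_le e)

theorem const_mem_lowDegree (a : ℝ) (e : ℕ) : (fun _ : ι → Bool => a) ∈ lowDegree ι e := by
  have h : (fun _ : ι → Bool => a) = a • 1 := funext fun _ => (mul_one a).symm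
  exact h ▸ Submodule.smul_mem _ _ (one_mem_lowDegree e)

theorem mul_mem_lowDegree {e e' : ℕ} {f g : (ι → Bool) → ℝ}
    (hf : f ∈ lowDegree ι e) (hg : g ∈ lowDegree ι e') : f * g ∈ lowDegree ι (e + e') := by
  classical
  have hfg := Submodule.mul_mem_mul hf hg
  rw [lowDegree, lowDegree, Submodule.span_mul_span] at hfg
  refine Submodule.span_le.mpr ?_ hfg
  rintro _ ⟨_, ⟨A, hA, rfl⟩, _, ⟨B, hB, rfl⟩, rfl⟩
  have hsub : symmDiff A B ⊆ A ∪ B := symmDiff_le_sup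
  have hmem := walsh_mem_lowDegree
    ((Finset.card_le_card hsub).trans ((Finset.card_union_le A B).trans (add_le_add hA hB)))
  rwa [← walsh_mul] at hmem

theorem prod_mem_lowDegree {κ : Type*} {s : Finset κ} {e : κ → ℕ} {f : κ → (ι → Bool) → ℝ}
    (hf : ∀ j ∈ s, f j ∈ lowDegree ι (e j)) : ∏ j ∈ s, f j ∈ lowDegree ι (∑ j ∈ s, e j) := by
  classical
  induction s using Finset.induction_on with
  | empty => exact one_mem_lowDegree _
  | insert j s hj ih =>
    rw [Finset.prod_insert hj, Finset.sum_insert hj]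
    exact mul_mem_lowDegree (hf j (Finset.mem_insert_self j s))
      (ih fun i hi => hf i (Finset.mem_insert_of_mem hi))

theorem bit_mem_lowDegree (i : ι) (φ : Bool → ℝ) :
    (fun x : ι → Bool => φ (x i)) ∈ lowDegree ι 1 := by
  have h : (fun x : ι → Bool => φ (x i)) =
      (fun _ => (φ false + φ true) / 2) + ((φ false - φ true) / 2) • walsh {i} := by
    ext x
    cases hx : x i <;> simp [walsh, bitVal, hx] <;> ring
  rw [h]
  exact Submodule.add_mem _ (const_mem_lowDegree _ _)
    (Submodule.smul_mem _ _ (walsh_mem_lowDegree (Finset.card_singleton i).le))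

theorem comp_mem_lowDegree {κ : Type*} [Fintype κ] (f : (κ → Bool) → ℝ) (v : κ → ι) :
    (fun x : ι → Bool => f (x ∘ v)) ∈ lowDegree ι (Fintype.card κ) := by
  classical
  have hsum : (fun x : ι → Bool => f (x ∘ v)) =
      ∑ y : κ → Bool, f y • ∏ j, fun x : ι → Bool => if x (v j) = y j then (1 : ℝ) else 0 := by
    ext x
    simp [Fintype.prod_boole, ← funext_iff, Function.comp_def]
  rw [hsum]
  refine Submodule.sum_mem _ fun y _ => Submodule.smul_mem _ _ ?_
  have hprod := prod_mem_lowDegree (s := Finset.univ)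
    fun j _ => bit_mem_lowDegree (v j) fun b => if b = y j then (1 : ℝ) else 0
  simpa only [Finset.sum_const, smul_eq_mul, mul_one, Finset.card_univ] using hprod

theorem walsh_mem_span_prod_bitVal (A : Finset ι) :
    walsh A ∈
      Submodule.span ℝ ((fun (B : Finset ι) x => ∏ i ∈ B, bitVal (x i)) '' {B | B ⊆ A}) := by
  classical
  have hsum : walsh A = ∑ B ∈ A.powerset, (-2 : ℝ) ^ B.card • fun x => ∏ i ∈ B, bitVal (x i) := by
    ext x
    simp_rw [walsh, sub_eq_add_neg, ← neg_mul]
    rw [Finset.prod_one_add, Finset.sum_apply]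
    simp only [Finset.prod_mul_distrib, Finset.prod_const, Pi.smul_apply, smul_eq_mul]
  rw [hsum]
  exact Submodule.sum_mem _ fun B hB => Submodule.smul_mem _ _
    (Submodule.subset_span ⟨B, Finset.mem_powerset.mp hB, rfl⟩)

theorem lowDegree_eq_span_prod_bitVal (e : ℕ) :
    lowDegree ι e =
      Submodule.span ℝ ((fun (A : Finset ι) x => ∏ i ∈ A, bitVal (x i)) '' {A | A.card ≤ e}) := by
  apply le_antisymm
  · refine Submodule.span_le.mpr ?_
    rintro _ ⟨A, hA, rfl⟩
    exact Submodule.span_mono (Set.image_mono fun B hBA => (Finset.card_le_card hBA).trans hA)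
      (walsh_mem_span_prod_bitVal A)
  · refine Submodule.span_le.mpr ?_
    rintro _ ⟨A, hA, rfl⟩
    have hprod := prod_mem_lowDegree (s := A) fun i _ => bit_mem_lowDegree i bitVal
    simp only [Finset.prod_fn, Finset.sum_const, smul_eq_mul, mul_one] at hprod
    exact lowDegree_mono hA hprod

theorem degreeLE_iff_mem_lowDegree {n e : ℕ} {f : Cube n → ℝ} :
    DegreeLE f e ↔ f ∈ lowDegree (Fin n) e := by
  have hset : {A : Finset (Fin n) | A.card ≤ e} =
      ((Finset.univ.filter fun A => A.card ≤ e : Finset (Finset (Fin n))) :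
        Set (Finset (Fin n))) := by
    simp
  rw [lowDegree_eq_span_prod_bitVal, hset, Submodule.mem_span_image_finset_iff_exists_fun']
  constructor
  · rintro ⟨a, ha, hfa⟩
    refine ⟨a, funext fun x => ?_⟩
    rw [hfa, Finset.sum_apply, Finset.sum_filter_of_ne]
    · rfl
    · exact fun A _ hA => not_lt.mp fun hlt => hA (by simp [ha A hlt])
  · rintro ⟨a, rfl⟩
    refine ⟨fun A => if A.card ≤ e then a A else 0, fun A hA => if_neg hA.not_ge, fun x => ?_⟩
    simp only [Finset.sum_apply, Pi.smul_apply, smul_eq_mul, Finset.sum_filter, ite_mul, zero_mul]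

end Walsh

section WalshExpansion

variable {ι : Type*} [Fintype ι] [DecidableEq ι]

/-- The coefficient of `walsh A` in the Walsh expansion of a function on the cube. -/
noncomputable def walshCoeff (A : Finset ι) : ((ι → Bool) → ℝ) →ₗ[ℝ] ℝ where
  toFun f := 𝔼 x, f x * walsh A x
  map_add' f g := by simp only [Pi.add_apply, add_mul, Finset.expect_add_distrib]
  map_smul' a f := by
    simp only [Pi.smul_apply, smul_eq_mul, mul_assoc, Finset.mul_expect, RingHom.id_apply]

theorem walshCoeff_apply (A : Finset ι) (f : (ι → Bool) → ℝ) :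
    walshCoeff A f = 𝔼 x, f x * walsh A x := rfl

/-- The part of the Walsh expansion of a function that is supported on the index family `𝒜`. -/
noncomputable def walshPart (𝒜 : Finset (Finset ι)) : ((ι → Bool) → ℝ) →ₗ[ℝ] ((ι → Bool) → ℝ) :=
  ∑ A ∈ 𝒜, (walshCoeff A).smulRight (walsh A)

theorem walshPart_apply (𝒜 : Finset (Finset ι)) (f : (ι → Bool) → ℝ) :
    walshPart 𝒜 f = ∑ A ∈ 𝒜, walshCoeff A f • walsh A := by
  simp only [walshPart, LinearMap.sum_apply, LinearMap.smulRight_apply]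

theorem walshCoeff_walsh (A B : Finset ι) :
    walshCoeff A (walsh B) = if B = A then 1 else 0 :=
  expect_walsh_mul_walsh B A

theorem walshCoeff_eq_zero {e : ℕ} {f : (ι → Bool) → ℝ} (hf : f ∈ lowDegree ι e) {A : Finset ι}
    (hA : e < A.card) : walshCoeff A f = 0 := by
  refine LinearMap.eqOn_span (f := walshCoeff A) (g := 0) ?_ hf
  rintro _ ⟨B, hB, rfl⟩
  rw [walshCoeff_walsh, LinearMap.zero_apply, if_neg]
  rintro rfl
  exact hA.not_ge hB

theorem walshPart_univ (f : (ι → Bool) → ℝ) : walshPart Finset.univ f = f := by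
  refine LinearMap.eqOn_span (f := walshPart Finset.univ) (g := LinearMap.id) ?_
    (comp_mem_lowDegree f id)
  rintro _ ⟨B, -, rfl⟩
  simp [walshPart_apply, walshCoeff_walsh]

theorem walshPart_of_mem_lowDegree {e : ℕ} {f : (ι → Bool) → ℝ} (hf : f ∈ lowDegree ι e) :
    walshPart (Finset.univ.filter fun A => A.card ≤ e) f = f := by
  conv_rhs => rw [← walshPart_univ f]
  rw [walshPart_apply, walshPart_apply, Finset.sum_filter_of_ne]
  intro A _ hA
  contrapose! hA
  rw [walshCoeff_eq_zero hf hA, zero_smul]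

theorem walshPart_add_walshPart_compl (𝒜 : Finset (Finset ι)) (f : (ι → Bool) → ℝ) :
    walshPart 𝒜 f + walshPart 𝒜ᶜ f = f := by
  rw [walshPart_apply, walshPart_apply, Finset.sum_add_sum_compl, ← walshPart_apply,
    walshPart_univ]

theorem expect_walshPart_sq (𝒜 : Finset (Finset ι)) (f : (ι → Bool) → ℝ) :
    𝔼 x, walshPart 𝒜 f x ^ 2 = ∑ A ∈ 𝒜, walshCoeff A f ^ 2 := by
  have hexp : ∀ x, walshPart 𝒜 f x ^ 2 = ∑ A ∈ 𝒜, ∑ B ∈ 𝒜,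
      walshCoeff A f * walshCoeff B f * (walsh A x * walsh B x) := fun x => by
    simp only [walshPart_apply, Finset.sum_apply, Pi.smul_apply, smul_eq_mul, sq,
      Finset.sum_mul_sum]
    exact Finset.sum_congr rfl fun A _ => Finset.sum_congr rfl fun B _ => by ring
  simp only [hexp, Finset.expect_sum_comm, ← Finset.mul_expect, expect_walsh_mul_walsh, mul_ite,
    mul_one, mul_zero, Finset.sum_ite_eq]
  exact Finset.sum_congr rfl fun A hA => by rw [if_pos hA, sq]

theorem expect_sq_eq_sum_walshCoeff_sq (f : (ι → Bool) → ℝ) :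
    𝔼 x, f x ^ 2 = ∑ A, walshCoeff A f ^ 2 := by
  rw [← expect_walshPart_sq, walshPart_univ]

end WalshExpansion

section PseudoDensity

theorem IsCubeSOS.add {n d : ℕ} {f g : Cube n → ℝ} (hf : IsCubeSOS d f) (hg : IsCubeSOS d g) :
    IsCubeSOS d (f + g) := by
  obtain ⟨t, u, hu, hfu⟩ := hf
  obtain ⟨t', u', hu', hgu⟩ := hg
  refine ⟨t + t', Fin.append u u', fun j => ?_, fun x => ?_⟩
  · refine Fin.addCases (fun i => ?_) (fun i => ?_) j
    · exact (Fin.append_left u u' i).symm ▸ hu i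
    · exact (Fin.append_right u u' i).symm ▸ hu' i
  · simp only [Fin.sum_univ_add, Fin.append_left, Fin.append_right, Pi.add_apply, hfu, hgu]

theorem isCubeSOS_sq {n d : ℕ} {g : Cube n → ℝ} (hg : g ∈ lowDegree (Fin n) (d / 2)) :
    IsCubeSOS d (g ^ 2) :=
  ⟨1, fun _ => g, fun _ => degreeLE_iff_mem_lowDegree.mpr hg, fun x => by simp⟩

theorem IsCubeSOS.smul {n d : ℕ} {f : Cube n → ℝ} (hf : IsCubeSOS d f) {a : ℝ} (ha : 0 ≤ a) :
    IsCubeSOS d (a • f) := by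
  obtain ⟨t, u, hu, hfu⟩ := hf
  refine ⟨t, fun j => √a • u j, fun j => ?_, fun x => ?_⟩
  · exact degreeLE_iff_mem_lowDegree.mpr
      (Submodule.smul_mem _ _ (degreeLE_iff_mem_lowDegree.mp (hu j)))
  · simp only [Pi.smul_apply, smul_eq_mul, hfu, mul_pow, Real.sq_sqrt ha, Finset.mul_sum]

theorem isCubeSOS_zero (n d : ℕ) : IsCubeSOS d (0 : Cube n → ℝ) :=
  ⟨0, Fin.elim0, fun j => j.elim0, fun _ => rfl⟩

theorem isCubeSOS_one (n d : ℕ) : IsCubeSOS d (1 : Cube n → ℝ) :=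
  one_pow (M := Cube n → ℝ) 2 ▸ isCubeSOS_sq (one_mem_lowDegree _)

theorem sosBound_le {n d : ℕ} {f : Cube n → ℝ} {v : ℝ} (h : IsCubeSOS d (fun x => v - f x)) :
    sosBound d f ≤ (v : EReal) :=
  sInf_le ⟨v, rfl, h⟩

/-- The convex cone of degree-`d` sums of squares on the cube. -/
def sosCone (n d : ℕ) : PointedCone ℝ (Cube n → ℝ) where
  carrier := {f | IsCubeSOS d f}
  add_mem' := IsCubeSOS.add
  zero_mem' := isCubeSOS_zero n d
  smul_mem' a _ hf := hf.smul a.2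

theorem mem_sosCone {n d : ℕ} {f : Cube n → ℝ} : f ∈ sosCone n d ↔ IsCubeSOS d f := Iff.rfl

theorem isCubeSOS_abs_add_smul_walsh {n d : ℕ} {A : Finset (Fin n)} (hA : A.card ≤ 2 * (d / 2))
    (a : ℝ) : IsCubeSOS d (|a| • 1 + a • walsh A) := by
  obtain ⟨B, hBA, hB⟩ := Finset.exists_subset_card_eq (min_le_right (d / 2) A.card)
  have hC : (A \ B).card ≤ d / 2 := by
    rw [Finset.card_sdiff_of_subset hBA]
    omega
  have hmem : walsh B + (SignType.sign a : ℝ) • walsh (A \ B) ∈ lowDegree (Fin n) (d / 2) :=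
    Submodule.add_mem _ (walsh_mem_lowDegree (by omega))
      (Submodule.smul_mem _ _ (walsh_mem_lowDegree hC))
  convert (isCubeSOS_sq hmem).smul (a := |a| / 2) (by positivity) using 1
  have hprod : walsh A = walsh B * walsh (A \ B) := by
    rw [← walsh_union Finset.disjoint_sdiff, Finset.union_sdiff_of_subset hBA]
  ext x
  have hBx := congrFun (walsh_mul_self B) x
  have hCx := congrFun (walsh_mul_self (A \ B)) x
  simp only [Pi.mul_apply, Pi.one_apply] at hBx hCx
  simp only [Pi.smul_apply, Pi.add_apply, Pi.pow_apply, Pi.mul_apply, Pi.one_apply, smul_eq_mul,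
    hprod]
  rcases lt_trichotomy a 0 with ha | rfl | ha
  · simp only [abs_of_neg ha, sign_neg ha, SignType.coe_neg_one]
    linear_combination (a / 2) * hBx + (a / 2) * hCx
  · simp
  · simp only [abs_of_pos ha, sign_pos ha, SignType.coe_one]
    linear_combination (-a / 2) * hBx + (-a / 2) * hCx

theorem isCubeSOS_sum_abs_add_walshPart {n d : ℕ} {𝒜 : Finset (Finset (Fin n))}
    (h𝒜 : ∀ A ∈ 𝒜, A.card ≤ 2 * (d / 2)) (f : Cube n → ℝ) :
    IsCubeSOS d ((∑ A ∈ 𝒜, |walshCoeff A f|) • 1 + walshPart 𝒜 f) := by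
  rw [walshPart_apply, Finset.sum_smul, ← Finset.sum_add_distrib, ← mem_sosCone]
  exact Submodule.sum_mem _ fun A hA => isCubeSOS_abs_add_smul_walsh (h𝒜 A hA) _

section OrderUnit

variable {E : Type*} [AddCommGroup E] [Module ℝ E] {C : PointedCone ℝ E} {e u : E}

theorem nonneg_of_smul_add_smul_mem (he : e ∈ C) (hunit : ∃ t : ℝ, t • e + u ∈ C) (hu : u ∉ C)
    {a b : ℝ} (hb : 0 ≤ b) (hmem : a • e + b • u ∈ C) : 0 ≤ a := by
  have smul_mem : ∀ {a : ℝ} {p : E}, 0 ≤ a → p ∈ C → a • p ∈ C := fun ha hp =>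
    Submodule.smul_mem C ⟨_, ha⟩ hp
  obtain ⟨t, ht⟩ := hunit
  have ht' : |t| • e + u ∈ C := by
    convert C.add_mem (smul_mem (sub_nonneg.mpr (le_abs_self t)) he) ht using 1
    module
  by_contra! ha
  have hpos : 0 < -a + |t| * b := by linarith [mul_nonneg (abs_nonneg t) hb]
  refine hu ?_
  convert smul_mem (inv_pos.mpr hpos).le
    (C.add_mem (smul_mem (abs_nonneg t) hmem) (smul_mem (neg_pos.mpr ha).le ht')) using 1
  rw [eq_inv_smul_iff₀ hpos.ne']
  module

theorem exists_linearMap_nonneg_of_orderUnit (he : e ∈ C)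
    (hunit : ∀ y, ∃ t : ℝ, t • e + y ∈ C) (hu : u ∉ C) :
    ∃ g : E →ₗ[ℝ] ℝ, g e = 1 ∧ g u ≤ 0 ∧ ∀ p ∈ C, 0 ≤ g p := by
  have he0 : e ≠ 0 := by
    rintro rfl
    obtain ⟨t, ht⟩ := hunit u
    exact hu (by rwa [smul_zero, zero_add] at ht)
  let F : E →ₗ.[ℝ] ℝ := LinearPMap.mkSpanSingleton e 1 he0
  have hF : ∀ (a : ℝ) (ha : a • e ∈ F.domain), F ⟨a • e, ha⟩ = a := fun _ ha =>
    (LinearPMap.mkSpanSingleton'_apply _ _ _ _ ha).trans (mul_one _)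
  have hnonneg : ∀ y : F.domain, (y : E) ∈ C ⊔ PointedCone.hull ℝ {-u} → 0 ≤ F y := by
    rintro ⟨_, hy⟩ hyC
    obtain ⟨a, rfl⟩ := Submodule.mem_span_singleton.mp hy
    obtain ⟨p, hp, _, hz, hsum⟩ := Submodule.mem_sup.mp hyC
    obtain ⟨b, rfl⟩ := Submodule.mem_span_singleton.mp hz
    have hmem : a • e + (b : ℝ) • u ∈ C := by
      convert hp using 1
      rw [← sub_eq_iff_eq_add.mpr hsum.symm, smul_neg, sub_neg_eq_add]
      rfl
    rw [hF]
    exact nonneg_of_smul_add_smul_mem he (hunit u) hu b.2 hmem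
  obtain ⟨g, hg, hgC⟩ := riesz_extension _ _ hnonneg fun y =>
    let ⟨t, ht⟩ := hunit y
    ⟨⟨t • e, Submodule.mem_span_singleton.mpr ⟨t, rfl⟩⟩, Submodule.mem_sup_left ht⟩
  have hge : g e = 1 := by
    have h : g ((1 : ℝ) • e) = 1 :=
      (hg ⟨_, Submodule.mem_span_singleton.mpr ⟨1, rfl⟩⟩).trans (hF 1 _)
    rwa [one_smul] at h
  have hgu := hgC (-u) (Submodule.mem_sup_right (Submodule.mem_span_singleton_self _))
  rw [map_neg, Left.nonneg_neg_iff] at hgu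
  exact ⟨g, hge, hgu, fun p hp => hgC p (Submodule.mem_sup_left hp)⟩

end OrderUnit

/-- `D` acts as a pseudo-density of order `h`: the functional `g ↦ 𝔼 x, D x * g x` is nonnegative
on the squares of functions of degree at most `h`, although `D` itself may take negative values. -/
def IsPseudoPositive {ι : Type*} [Fintype ι] [DecidableEq ι] (h : ℕ) (D : (ι → Bool) → ℝ) :
    Prop :=
  ∀ g ∈ lowDegree ι h, 0 ≤ 𝔼 x, D x * g x ^ 2

theorem exists_pseudoExpectation {n d : ℕ} {f : Cube n → ℝ} {v : ℝ}
    (hf : f ∈ lowDegree (Fin n) (2 * (d / 2))) (hv : ¬ sosBound d f ≤ (v : EReal)) :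
    ∃ L : (Cube n → ℝ) →ₗ[ℝ] ℝ, L 1 = 1 ∧ L (fun x => v - f x) ≤ 0 ∧
      (∀ A : Finset (Fin n), A.card ≤ 2 * (d / 2) → |L (walsh A)| ≤ 1) ∧
      ∀ g ∈ lowDegree (Fin n) (d / 2), 0 ≤ L (g ^ 2) := by
  set 𝒜 : Finset (Finset (Fin n)) := Finset.univ.filter fun A => A.card ≤ 2 * (d / 2)
  have hpart : ∀ {p}, p ∈ lowDegree (Fin n) (2 * (d / 2)) → walshPart 𝒜 p = p :=
    walshPart_of_mem_lowDegree
  have hmem : ∀ {p}, p ∈ lowDegree (Fin n) (2 * (d / 2)) →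
      (p ∈ (sosCone n d).comap (walshPart 𝒜) ↔ IsCubeSOS d p) := fun hp => by
    rw [PointedCone.mem_comap, hpart hp, mem_sosCone]
  have hu : (fun x => v - f x) ∈ lowDegree (Fin n) (2 * (d / 2)) :=
    Submodule.sub_mem _ (const_mem_lowDegree v _) hf
  obtain ⟨L, hL1, hLu, hL⟩ := exists_linearMap_nonneg_of_orderUnit
    ((hmem (one_mem_lowDegree _)).mpr (isCubeSOS_one n d))
    (fun y => ⟨∑ A ∈ 𝒜, |walshCoeff A y|, by
      rw [PointedCone.mem_comap, map_add, map_smul, hpart (one_mem_lowDegree _)]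
      exact isCubeSOS_sum_abs_add_walshPart (fun A hA => (Finset.mem_filter.mp hA).2) y⟩)
    (fun h => hv (sosBound_le ((hmem hu).mp h)))
  refine ⟨L, hL1, hLu, fun A hA => ?_, fun g hg => hL _ ((hmem ?_).mpr (isCubeSOS_sq hg))⟩
  · have hnonneg : ∀ a : ℝ, 0 ≤ |a| + a * L (walsh A) := fun a => by
      have := hL _ ((hmem (Submodule.add_mem _ (Submodule.smul_mem _ _ (one_mem_lowDegree _))
        (Submodule.smul_mem _ _ (walsh_mem_lowDegree hA)))).mpr (isCubeSOS_abs_add_smul_walsh hA a))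
      rwa [map_add, map_smul, map_smul, hL1, smul_eq_mul, smul_eq_mul, mul_one] at this
    have h₁ := hnonneg 1
    have h₂ := hnonneg (-1)
    rw [abs_neg] at h₂
    rw [abs_one] at h₁ h₂
    exact abs_le.mpr ⟨by linarith, by linarith⟩
  · rw [sq, two_mul]
    exact mul_mem_lowDegree hg hg

theorem card_filter_card_le (n e : ℕ) :
    (Finset.univ.filter fun A : Finset (Fin n) => A.card ≤ e).card ≤ (n + 1) ^ e := by
  have hsub : (Finset.univ.filter fun A : Finset (Fin n) => A.card ≤ e) ⊆
      (Finset.range (e + 1)).biUnion fun i => Finset.powersetCard i Finset.univ := by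
    intro A hA
    have := (Finset.mem_filter.mp hA).2
    simp only [Finset.mem_biUnion, Finset.mem_range, Finset.mem_powersetCard]
    exact ⟨A.card, by omega, Finset.subset_univ A, rfl⟩
  refine (Finset.card_le_card hsub).trans (Finset.card_biUnion_le.trans ?_)
  rw [add_pow]
  refine Finset.sum_le_sum fun i hi => ?_
  rw [Finset.card_powersetCard, Finset.card_univ, Fintype.card_fin, one_pow, mul_one]
  exact (Nat.choose_le_pow n i).trans
    (Nat.le_mul_of_pos_right _ (Nat.choose_pos (Nat.lt_succ_iff.mp (Finset.mem_range.mp hi))))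

theorem exists_pseudoDensity {n d : ℕ} {f : Cube n → ℝ} {v : ℝ}
    (hf : f ∈ lowDegree (Fin n) (2 * (d / 2))) (hv : ¬ sosBound d f ≤ (v : EReal)) :
    ∃ D : Cube n → ℝ, (∀ x, |D x| ≤ ((n : ℝ) + 1) ^ d) ∧ IsPseudoPositive (d / 2) D ∧
      𝔼 x, D x = 1 ∧ 𝔼 x, D x * (v - f x) ≤ 0 := by
  obtain ⟨L, hL1, hLu, hLabs, hLsq⟩ := exists_pseudoExpectation hf hv
  set 𝒜 : Finset (Finset (Fin n)) := Finset.univ.filter fun A => A.card ≤ 2 * (d / 2)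
  let D : Cube n → ℝ := fun x => ∑ A ∈ 𝒜, L (walsh A) * walsh A x
  have hDL : ∀ p ∈ lowDegree (Fin n) (2 * (d / 2)), 𝔼 x, D x * p x = L p := fun p hp => by
    conv_rhs => rw [← walshPart_of_mem_lowDegree hp, walshPart_apply, map_sum]
    simp only [D, Finset.sum_mul, Finset.expect_sum_comm, map_smul, smul_eq_mul, walshCoeff_apply,
      Finset.expect_mul]
    exact Finset.sum_congr rfl fun A _ => Finset.expect_congr rfl fun x _ => by ring
  refine ⟨D, fun x => ?_, fun g hg => ?_, ?_, ?_⟩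
  · calc |D x| ≤ ∑ A ∈ 𝒜, |L (walsh A) * walsh A x| := Finset.abs_sum_le_sum_abs _ _
      _ ≤ ∑ A ∈ 𝒜, 1 := Finset.sum_le_sum fun A hA => by
          rw [abs_mul, abs_walsh, mul_one]
          exact hLabs A (Finset.mem_filter.mp hA).2
      _ ≤ ((n : ℝ) + 1) ^ (2 * (d / 2)) := by
          rw [Finset.sum_const, nsmul_eq_mul, mul_one]
          exact_mod_cast card_filter_card_le n (2 * (d / 2))
      _ ≤ ((n : ℝ) + 1) ^ d := pow_le_pow_right₀ (by norm_num) (Nat.mul_div_le d 2)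
  · refine (hLsq g hg).trans_eq (hDL (g ^ 2) ?_).symm
    rw [sq, two_mul]
    exact mul_mem_lowDegree hg hg
  · simpa only [Pi.one_apply, mul_one, hL1] using hDL 1 (one_mem_lowDegree _)
  · exact (hDL _ (Submodule.sub_mem _ (const_mem_lowDegree v _) hf)).trans_le hLu

end PseudoDensity

section TraceForm

variable {m : Type*} [Fintype m]

open scoped MatrixOrder in
theorem exists_eq_transpose_mul_self {A : Matrix m m ℝ} (hA : A.PosSemidef) :
    ∃ C : Matrix m m ℝ, A = C.transpose * C := by
  classical
  obtain ⟨C, hC⟩ := CStarAlgebra.nonneg_iff_eq_star_mul_self.mp hA.nonneg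
  exact ⟨C, by rwa [← Matrix.conjTranspose_eq_transpose_of_trivial]⟩

omit [Fintype m] in
theorem transpose_eq_of_posSemidef {A : Matrix m m ℝ} (hA : A.PosSemidef) : A.transpose = A := by
  rw [← Matrix.conjTranspose_eq_transpose_of_trivial, hA.isHermitian.eq]

theorem posSemidef_mul_mul_transpose {A : Matrix m m ℝ} (hA : A.PosSemidef) (C : Matrix m m ℝ) :
    (C * A * C.transpose).PosSemidef := by
  simpa only [Matrix.conjTranspose_eq_transpose_of_trivial] using hA.mul_mul_conjTranspose_same C

theorem posSemidef_transpose_mul_mul {A : Matrix m m ℝ} (hA : A.PosSemidef) (C : Matrix m m ℝ) :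
    (C.transpose * A * C).PosSemidef := by
  simpa only [Matrix.conjTranspose_eq_transpose_of_trivial] using hA.conjTranspose_mul_mul_same C

theorem trace_mul_nonneg {A B : Matrix m m ℝ} (hA : A.PosSemidef) (hB : B.PosSemidef) :
    0 ≤ (A * B).trace := by
  obtain ⟨C, rfl⟩ := exists_eq_transpose_mul_self hA
  rw [Matrix.mul_assoc, Matrix.trace_mul_comm]
  exact (posSemidef_mul_mul_transpose hB C).trace_nonneg

theorem trace_mul_le_of_posSemidef_sub {A B C : Matrix m m ℝ} (hAB : (B - A).PosSemidef)
    (hC : C.PosSemidef) : (A * C).trace ≤ (B * C).trace := by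
  rw [← sub_nonneg, ← Matrix.trace_sub, ← Matrix.sub_mul]
  exact trace_mul_nonneg hAB hC

theorem trace_vecMulVec_mul (v : m → ℝ) (A : Matrix m m ℝ) :
    (Matrix.vecMulVec v v * A).trace = v ⬝ᵥ A.mulVec v := by
  rw [Matrix.vecMulVec_mul, Matrix.trace_vecMulVec, dotProduct_comm, ← Matrix.dotProduct_mulVec]

omit [Fintype m] in
theorem posSemidef_vecMulVec_self [Finite m] (v : m → ℝ) : (Matrix.vecMulVec v v).PosSemidef := by
  simpa only [star_trivial] using Matrix.posSemidef_vecMulVec_self_star v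

theorem posSemidef_of_forall_trace_vecMulVec_nonneg {A : Matrix m m ℝ} (hA : A.transpose = A)
    (h : ∀ v, 0 ≤ (Matrix.vecMulVec v v * A).trace) : A.PosSemidef := by
  refine Matrix.PosSemidef.of_dotProduct_mulVec_nonneg ?_ fun v => ?_
  · rwa [Matrix.IsHermitian, Matrix.conjTranspose_eq_transpose_of_trivial]
  · rw [star_trivial, ← trace_vecMulVec_mul]
    exact h v

omit [Fintype m] in
theorem posSemidef_expect [Finite m] {σ : Type*} (s : Finset σ) {A : σ → Matrix m m ℝ}
    (hA : ∀ i ∈ s, (A i).PosSemidef) : (𝔼 i ∈ s, A i).PosSemidef := by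
  rw [Finset.expect, ← NNRat.cast_smul_eq_nnqsmul ℝ]
  exact (Matrix.posSemidef_sum s hA).smul (NNRat.cast_nonneg _)

theorem trace_mul_expect {σ : Type*} (s : Finset σ) (A : Matrix m m ℝ) (B : σ → Matrix m m ℝ) :
    (A * 𝔼 i ∈ s, B i).trace = 𝔼 i ∈ s, (A * B i).trace :=
  map_expect (((Matrix.traceLinearMap m ℝ ℝ).comp (LinearMap.mulLeft ℝ A)).restrictScalars ℚ≥0) _ _

theorem trace_expect_mul {σ : Type*} (s : Finset σ) (A : Matrix m m ℝ) (B : σ → Matrix m m ℝ) :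
    ((𝔼 i ∈ s, B i) * A).trace = 𝔼 i ∈ s, (B i * A).trace :=
  map_expect (((Matrix.traceLinearMap m ℝ ℝ).comp (LinearMap.mulRight ℝ A)).restrictScalars ℚ≥0)
    _ _

end TraceForm

section Duality

variable {k n r : ℕ} {P : BoolCSP k} (R : SDPRelaxation P n r) {I : CSPInstance P n} {c : ℝ}

theorem SDPRelaxation.frobInner_le (hI : R.value I ≤ (c : EReal)) {y : Matrix (Fin r) (Fin r) ℝ}
    (hy : y ∈ R.feasible) : frobInner (R.linInstance I) y ≤ c :=
  EReal.coe_le_coe_iff.mp <| (le_iSup₂ (f := fun y (_ : y ∈ R.feasible) =>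
    ((frobInner (R.linInstance I) y : ℝ) : EReal)) y hy).trans hI

theorem SDPRelaxation.sum_mul_value_le_of_pos (hI : R.value I ≤ (c : EReal)) {w : Cube n → ℝ}
    (hw : 0 < ∑ x, w x) (hpsd : (∑ x, w x • R.linAssignment x).PosSemidef) :
    ∑ x, w x * I.value x ≤ (∑ x, w x) * c := by
  have hfeas : (∑ x, w x)⁻¹ • ∑ x, w x • R.linAssignment x ∈ R.feasible := by
    refine ⟨hpsd.smul (inv_nonneg.mpr hw.le), ?_⟩
    simp_rw [map_smul, map_sum, map_smul, R.map_assignment]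
    rw [← Finset.sum_smul, smul_smul, inv_mul_cancel₀ hw.ne', one_smul]
  have h := R.frobInner_le hI hfeas
  rw [frobInner, Matrix.mul_smul, Matrix.trace_smul, smul_eq_mul, inv_mul_le_iff₀ hw,
    Matrix.mul_sum, Matrix.trace_sum] at h
  calc ∑ x, w x * I.value x
      = ∑ x, ((R.linInstance I).transpose * w x • R.linAssignment x).trace :=
        Finset.sum_congr rfl fun x _ => by
          rw [← R.inner_eq, frobInner, Matrix.mul_smul, Matrix.trace_smul, smul_eq_mul]
    _ ≤ (∑ x, w x) * c := h

theorem SDPRelaxation.sum_mul_value_le (hI : R.value I ≤ (c : EReal)) {w : Cube n → ℝ}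
    (hw : 0 ≤ ∑ x, w x) (hpsd : (∑ x, w x • R.linAssignment x).PosSemidef) :
    ∑ x, w x * I.value x ≤ (∑ x, w x) * c := by
  have hperturbed (τ : ℝ) (hτ : 0 < τ) :
      ∑ x, (w x + τ) * I.value x ≤ (∑ x, (w x + τ)) * c := by
    refine R.sum_mul_value_le_of_pos hI ?_ ?_
    · rw [Finset.sum_add_distrib]
      exact add_pos_of_nonneg_of_pos hw (Finset.sum_pos (fun _ _ => hτ) Finset.univ_nonempty)
    · simp_rw [add_smul, Finset.sum_add_distrib]
      exact hpsd.add (Matrix.posSemidef_sum _ fun x _ =>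
        (R.posSemidef_assignment x).smul hτ.le)
  have hlim (f : ℝ → ℝ) (hf : Continuous f) : Filter.Tendsto f (nhdsWithin 0 (Set.Ioi 0))
      (nhds (f 0)) := (hf.tendsto 0).mono_left nhdsWithin_le_nhds
  simpa only [add_zero] using le_of_tendsto_of_tendsto
    (hlim (fun τ => ∑ x, (w x + τ) * I.value x) (by fun_prop))
    (hlim (fun τ => (∑ x, (w x + τ)) * c) (by fun_prop))
    (Filter.eventually_of_mem self_mem_nhdsWithin hperturbed)

/-- The functions on the cube that a relaxation certifies to be nonnegative on its spectrahedron
without using its linear equations: `x ↦ ⟨M, x̃⟩ + l` with `M ⪰ 0` and `l ≥ 0`. -/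
def SDPRelaxation.certificateCone : PointedCone ℝ (Cube n → ℝ) where
  carrier := {φ | ∃ M : Matrix (Fin r) (Fin r) ℝ, M.PosSemidef ∧ ∃ l : ℝ, 0 ≤ l ∧
    ∀ x, φ x = (M * R.linAssignment x).trace + l}
  zero_mem' := ⟨0, Matrix.PosSemidef.zero, 0, le_rfl, by simp⟩
  add_mem' := by
    rintro φ ψ ⟨M, hM, l, hl, hφ⟩ ⟨M', hM', l', hl', hψ⟩
    refine ⟨M + M', hM.add hM', l + l', add_nonneg hl hl', fun x => ?_⟩
    rw [Pi.add_apply, hφ, hψ, Matrix.add_mul, Matrix.trace_add]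
    ring
  smul_mem' := by
    rintro a φ ⟨M, hM, l, hl, hφ⟩
    refine ⟨(a : ℝ) • M, hM.smul a.2, a * l, mul_nonneg a.2 hl, fun x => ?_⟩
    rw [Pi.smul_apply, hφ, Matrix.smul_mul, Matrix.trace_smul, smul_eq_mul]
    exact mul_add _ _ _

theorem SDPRelaxation.sub_value_mem_closure_certificateCone (hI : R.value I ≤ (c : EReal)) :
    (fun x => c - I.value x) ∈ Submodule.closure R.certificateCone := by
  by_contra hnot
  obtain ⟨f, hf, hneg⟩ := ProperCone.hyperplane_separation_point
    (Submodule.closure R.certificateCone) hnot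
  have hfC (φ : Cube n → ℝ) (hφ : φ ∈ R.certificateCone) : 0 ≤ f φ :=
    hf φ (subset_closure hφ)
  let w : Cube n → ℝ := fun x => f fun y => if x = y then 1 else 0
  have hfw (φ : Cube n → ℝ) : f φ = ∑ x, w x * φ x := by
    have h := LinearMap.pi_apply_eq_sum_univ f.toLinearMap φ
    simpa only [w, smul_eq_mul, mul_comm, ContinuousLinearMap.coe_coe] using h
  have hw : 0 ≤ ∑ x, w x := by
    simpa only [hfw, mul_one] using hfC (fun _ => 1)
      ⟨0, Matrix.PosSemidef.zero, 1, zero_le_one, by simp⟩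
  have hpsd : (∑ x, w x • R.linAssignment x).PosSemidef := by
    refine posSemidef_of_forall_trace_vecMulVec_nonneg ?_ fun v => ?_
    · simp_rw [Matrix.transpose_sum, Matrix.transpose_smul,
        transpose_eq_of_posSemidef (R.posSemidef_assignment _)]
    · have h := hfC (fun x => (Matrix.vecMulVec v v * R.linAssignment x).trace)
        ⟨_, posSemidef_vecMulVec_self v, 0, le_rfl, by simp⟩
      rw [hfw] at h
      simpa only [Matrix.mul_sum, Matrix.trace_sum, Matrix.mul_smul, Matrix.trace_smul,
        smul_eq_mul] using h
  have h := R.sum_mul_value_le hI hw hpsd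
  rw [hfw] at hneg
  simp only [mul_sub, Finset.sum_sub_distrib, ← Finset.sum_mul] at hneg
  linarith

theorem SDPRelaxation.exists_certificate (hI : R.value I ≤ (c : EReal)) {δ : ℝ} (hδ : 0 < δ) :
    ∃ M : Matrix (Fin r) (Fin r) ℝ, M.PosSemidef ∧ ∃ l : ℝ, 0 ≤ l ∧
      ∀ x, |c - I.value x - ((M * R.linAssignment x).trace + l)| ≤ δ := by
  obtain ⟨φ, ⟨M, hM, l, hl, hφ⟩, hdist⟩ := Metric.mem_closure_iff.mp
    (R.sub_value_mem_closure_certificateCone hI) δ hδ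
  refine ⟨M, hM, l, hl, fun x => ?_⟩
  rw [← hφ, ← Real.dist_eq]
  exact ((dist_pi_lt_iff hδ).mp hdist x).le

end Duality

section Normalization

variable {m : Type*} [Fintype m] [DecidableEq m]

theorem exists_isUnit_det_eq_transpose_mul_self {A : Matrix m m ℝ} (hA : A.PosDef) :
    ∃ C : Matrix m m ℝ, IsUnit C.det ∧ A = C.transpose * C := by
  obtain ⟨C, rfl⟩ := exists_eq_transpose_mul_self hA.posSemidef
  have hdet := (Matrix.isUnit_iff_isUnit_det _).mp hA.isUnit
  rw [Matrix.det_mul] at hdet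
  exact ⟨C, isUnit_of_mul_isUnit_right hdet, rfl⟩

theorem trace_congr_mul_congr {C : Matrix m m ℝ} (hC : IsUnit C.det) (A B : Matrix m m ℝ) :
    (C⁻¹.transpose * A * C⁻¹ * (C * B * C.transpose)).trace = (A * B).trace := by
  have hCt : C.transpose * C⁻¹.transpose = 1 := by
    rw [← Matrix.transpose_mul, Matrix.nonsing_inv_mul _ hC, Matrix.transpose_one]
  calc (C⁻¹.transpose * A * C⁻¹ * (C * B * C.transpose)).trace
      = (C⁻¹.transpose * (A * (C⁻¹ * C) * B * C.transpose)).trace := by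
        simp only [Matrix.mul_assoc]
    _ = (A * B * (C.transpose * C⁻¹.transpose)).trace := by
        rw [Matrix.nonsing_inv_mul _ hC, Matrix.mul_one, Matrix.trace_mul_comm, Matrix.mul_assoc]
    _ = (A * B).trace := by rw [hCt, Matrix.mul_one]

theorem transpose_inv_mul_transpose_mul_self_mul_inv {C : Matrix m m ℝ} (hC : IsUnit C.det) :
    C⁻¹.transpose * (C.transpose * C) * C⁻¹ = 1 := by
  rw [← Matrix.mul_assoc, ← Matrix.transpose_mul, Matrix.mul_nonsing_inv _ hC,
    Matrix.transpose_one, Matrix.one_mul, Matrix.mul_nonsing_inv _ hC]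

/-- The congruence that turns `δ • 1 + 𝔼 S, P S` into the identity does the rescaling. -/
theorem exists_normalized_factorization {σ X : Type*} [Fintype σ] [Nonempty σ] [Finite X]
    {P : σ → Matrix m m ℝ} {Q : X → Matrix m m ℝ} (hP : ∀ S, (P S).PosSemidef)
    (hQ : ∀ x, (Q x).PosSemidef) {t : ℝ} (hPQ : ∀ S x, (P S * Q x).trace ≤ t) :
    ∃ (P' : σ → Matrix m m ℝ) (Q' : X → Matrix m m ℝ),
      (∀ S, (P' S).PosSemidef) ∧ (∀ x, (Q' x).PosSemidef) ∧
      (∀ S x, (P' S * Q' x).trace = (P S * Q x).trace) ∧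
      (1 - 𝔼 S, P' S).PosSemidef ∧ ∀ x, (Q' x).trace ≤ 1 + t := by
  obtain ⟨δ, hδ, hδQ⟩ : ∃ δ : ℝ, 0 < δ ∧ ∀ x, δ * (Q x).trace ≤ 1 := by
    cases nonempty_fintype X
    have hpos : 0 ≤ ∑ x, (Q x).trace := Finset.sum_nonneg fun x _ => (hQ x).trace_nonneg
    refine ⟨(1 + ∑ x, (Q x).trace)⁻¹, by positivity, fun x => ?_⟩
    rw [inv_mul_le_iff₀ (by positivity), mul_one]
    exact (Finset.single_le_sum (fun x _ => (hQ x).trace_nonneg) (Finset.mem_univ x)).trans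
      (le_add_of_nonneg_left zero_le_one)
  obtain ⟨C, hC, hCC⟩ := exists_isUnit_det_eq_transpose_mul_self
    ((Matrix.PosDef.one (n := m) (R := ℝ)).smul hδ |>.add_posSemidef
      (posSemidef_expect Finset.univ fun S _ => hP S))
  refine ⟨fun S => C⁻¹.transpose * P S * C⁻¹, fun x => C * Q x * C.transpose,
    fun S => posSemidef_transpose_mul_mul (hP S) _,
    fun x => posSemidef_mul_mul_transpose (hQ x) C,
    fun S x => trace_congr_mul_congr hC _ _, ?_, fun x => ?_⟩
  · have h : 1 - 𝔼 S, C⁻¹.transpose * P S * C⁻¹ =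
        C⁻¹.transpose * (δ • (1 : Matrix m m ℝ)) * C⁻¹ := by
      rw [← Finset.expect_mul, ← Finset.mul_expect, sub_eq_iff_eq_add, ← Matrix.add_mul,
        ← Matrix.mul_add, hCC, transpose_inv_mul_transpose_mul_self_mul_inv hC]
    rw [h]
    exact posSemidef_transpose_mul_mul (Matrix.PosSemidef.one.smul hδ.le) _
  · calc (C * Q x * C.transpose).trace = ((C.transpose * C) * Q x).trace := by
          rw [Matrix.mul_assoc, Matrix.trace_mul_comm, Matrix.mul_assoc, Matrix.trace_mul_comm]
      _ = δ * (Q x).trace + 𝔼 S, (P S * Q x).trace := by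
          rw [← hCC, Matrix.add_mul, Matrix.trace_add, trace_expect_mul, Matrix.smul_mul,
            Matrix.one_mul, Matrix.trace_smul, smul_eq_mul]
      _ ≤ 1 + t := add_le_add (hδQ x)
          (Finset.expect_le Finset.univ_nonempty fun S _ => hPQ S x)

end Normalization

section Spectral

variable {m : Type*} [Fintype m] [DecidableEq m] {b η t : ℝ}

theorem pow_shift_mul_le {l : ℝ} (hη : 0 < η) (hl : l ≤ b) (hl' : -b ≤ l) (T : ℕ) :
    (b - l) ^ (2 * T) * (l + η) ≤
      (b + η) ^ (2 * T + 1) + (b + 2 * η) ^ (2 * T) * min 0 (l + 2 * η) := by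
  have hb : 0 ≤ b := by linarith
  rcases le_total (-η) l with hlarge | hsmall
  · rw [min_eq_left (by linarith), mul_zero, add_zero, pow_succ]
    exact mul_le_mul (pow_le_pow_left₀ (by linarith) (by linarith) _) (by linarith)
      (by linarith) (by positivity)
  have hpow : 0 ≤ (b - l) ^ (2 * T) := pow_nonneg (by linarith) _
  refine le_add_of_nonneg_of_le (by positivity) ?_
  rcases le_total (-(2 * η)) l with hmid | htail
  · rw [min_eq_left (by linarith), mul_zero]
    exact mul_nonpos_of_nonneg_of_nonpos hpow (by linarith)
  · rw [min_eq_right (by linarith)]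
    calc (b - l) ^ (2 * T) * (l + η) ≤ (b - l) ^ (2 * T) * (l + 2 * η) := by gcongr; linarith
      _ ≤ (b + 2 * η) ^ (2 * T) * (l + 2 * η) := mul_le_mul_of_nonpos_right
          (pow_le_pow_left₀ (by linarith) (by linarith) _) (by linarith)

theorem sum_min_zero_le_trace_mul_diagonal_div {Q : Matrix m m ℝ} (hQ : Q.PosSemidef)
    (ht : 0 < t) (hQt : Q.trace ≤ t) (v : m → ℝ) :
    ∑ i, min 0 (v i) ≤ (Q * Matrix.diagonal v).trace / t := by
  simp only [le_div_iff₀ ht, Finset.sum_mul, Matrix.trace, Matrix.diag_apply, Matrix.mul_diagonal]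
  refine Finset.sum_le_sum fun i _ => ?_
  have hii : Q i i ≤ t := (Finset.single_le_sum (f := fun i => Q i i)
    (fun i _ => hQ.diag_nonneg) (Finset.mem_univ i)).trans hQt
  rcases le_total 0 (v i) with hv | hv
  · rw [min_eq_left hv, zero_mul]
    exact mul_nonneg hQ.diag_nonneg hv
  · rw [min_eq_right hv, mul_comm]
    exact mul_le_mul_of_nonpos_right hii hv

theorem trace_pow_shift_diagonal_mul_le {Q : Matrix m m ℝ} (hη : 0 < η) (ht : 0 < t) {l : m → ℝ}
    (hl : ∀ i, l i ≤ b) (hl' : ∀ i, -b ≤ l i) (hQ : Q.PosSemidef) (hQt : Q.trace ≤ t) (T : ℕ) :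
    ((b • 1 - Matrix.diagonal l) ^ (2 * T) * (Matrix.diagonal l + η • 1)).trace ≤
      Fintype.card m * (b + η) ^ (2 * T + 1) +
        (b + 2 * η) ^ (2 * T) * ((Q * (Matrix.diagonal l + (2 * η) • 1)).trace / t) := by
  have hshift (a : ℝ) : Matrix.diagonal l + a • 1 = Matrix.diagonal fun i => l i + a := by
    rw [← Matrix.diagonal_one, ← Matrix.diagonal_smul, Matrix.diagonal_add]
    simp
  have hsub : b • 1 - Matrix.diagonal l = Matrix.diagonal fun i => b - l i := by
    rw [← Matrix.diagonal_one, ← Matrix.diagonal_smul, Matrix.diagonal_sub]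
    simp
  rw [hshift, hshift, hsub, Matrix.diagonal_pow, Matrix.diagonal_mul_diagonal,
    Matrix.trace_diagonal]
  calc ∑ i, (b - l i) ^ (2 * T) * (l i + η)
      ≤ ∑ i, ((b + η) ^ (2 * T + 1) + (b + 2 * η) ^ (2 * T) * min 0 (l i + 2 * η)) :=
        Finset.sum_le_sum fun i _ => pow_shift_mul_le hη (hl i) (hl' i) T
    _ = Fintype.card m * (b + η) ^ (2 * T + 1) +
        (b + 2 * η) ^ (2 * T) * ∑ i, min 0 (l i + 2 * η) := by
        rw [Finset.sum_add_distrib, ← Finset.mul_sum, Finset.sum_const, nsmul_eq_mul,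
          Finset.card_univ]
    _ ≤ _ := by
        gcongr
        · rw [pow_mul]
          positivity
        · exact sum_min_zero_le_trace_mul_diagonal_div hQ ht hQt _

theorem trace_conjStarAlgAut (U : unitary (Matrix m m ℝ)) (A : Matrix m m ℝ) :
    (Unitary.conjStarAlgAut ℝ _ U A).trace = A.trace := by
  rw [Unitary.conjStarAlgAut_apply, Matrix.trace_mul_comm, ← Matrix.mul_assoc,
    Unitary.coe_star_mul_self, Matrix.one_mul]

theorem posSemidef_conjStarAlgAut_iff (U : unitary (Matrix m m ℝ)) (A : Matrix m m ℝ) :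
    (Unitary.conjStarAlgAut ℝ _ U A).PosSemidef ↔ A.PosSemidef := by
  rw [Unitary.conjStarAlgAut_apply]
  exact Matrix.IsUnit.posSemidef_star_right_conjugate_iff Unitary.isUnit_coe

/-- The spectral weight of `(b - F) ^ (2 * T)` concentrates on the negative part of `F` as soon as
some `Q` of bounded trace does. -/
theorem trace_pow_shift_mul_le {F Q : Matrix m m ℝ} (hη : 0 < η) (ht : 0 < t)
    (hF : F.IsHermitian) (hFb : (b • 1 - F).PosSemidef) (hFb' : (b • 1 + F).PosSemidef)
    (hQ : Q.PosSemidef) (hQt : Q.trace ≤ t) (T : ℕ) :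
    ((b • 1 - F) ^ (2 * T) * (F + η • 1)).trace ≤
      Fintype.card m * (b + η) ^ (2 * T + 1) +
        (b + 2 * η) ^ (2 * T) * ((Q * (F + (2 * η) • 1)).trace / t) := by
  obtain ⟨U, l, rfl⟩ : ∃ (U : unitary (Matrix m m ℝ)) (l : m → ℝ),
      F = Unitary.conjStarAlgAut ℝ _ U (Matrix.diagonal l) :=
    ⟨_, _, hF.spectral_theorem⟩
  obtain ⟨Q, rfl⟩ : ∃ Q', Q = Unitary.conjStarAlgAut ℝ _ U Q' :=
    ⟨_, ((Unitary.conjStarAlgAut ℝ (Matrix m m ℝ) U).apply_symm_apply Q).symm⟩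
  have hone (a : ℝ) : a • (1 : Matrix m m ℝ) = Unitary.conjStarAlgAut ℝ _ U (a • 1) := by
    rw [map_smul, map_one]
  rw [posSemidef_conjStarAlgAut_iff] at hQ
  rw [trace_conjStarAlgAut] at hQt
  rw [hone, ← map_sub, posSemidef_conjStarAlgAut_iff] at hFb
  rw [hone, ← map_add, posSemidef_conjStarAlgAut_iff] at hFb'
  rw [hone, hone η, hone (2 * η)]
  simp only [← map_sub, ← map_add, ← map_pow, ← map_mul, trace_conjStarAlgAut]
  refine trace_pow_shift_diagonal_mul_le hη ht (fun i => ?_) (fun i => ?_) hQ hQt T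
  · simpa using hFb.diag_nonneg (i := i)
  · simpa [neg_le_iff_add_nonneg'] using hFb'.diag_nonneg (i := i)

theorem expect_trace_pow_shift_mul_neg {X : Type*} [Fintype X] [Nonempty X]
    {F Q : X → Matrix m m ℝ} {T : ℕ} (hη : 0 < η) (ht : 0 < t)
    (hF : ∀ x, (F x).IsHermitian) (hFb : ∀ x, (b • 1 - F x).PosSemidef)
    (hFb' : ∀ x, (b • 1 + F x).PosSemidef) (hQ : ∀ x, (Q x).PosSemidef)
    (hQt : ∀ x, (Q x).trace ≤ t) (hneg : 𝔼 x, (Q x * F x).trace ≤ -(4 * t * η))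
    (hT : Fintype.card m * (b + η) ^ (2 * T + 1) < 2 * η * (b + 2 * η) ^ (2 * T)) :
    𝔼 x, ((b • 1 - F x) ^ (2 * T) * (F x + η • 1)).trace < 0 := by
  have hpow : 0 ≤ (b + 2 * η) ^ (2 * T) := (even_two_mul T).pow_nonneg _
  calc 𝔼 x, ((b • 1 - F x) ^ (2 * T) * (F x + η • 1)).trace
      ≤ 𝔼 x, (Fintype.card m * (b + η) ^ (2 * T + 1) +
          (b + 2 * η) ^ (2 * T) * (((Q x * F x).trace + 2 * η * t) / t)) := by
        refine Finset.expect_le_expect fun x _ => (trace_pow_shift_mul_le hη ht (hF x) (hFb x)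
          (hFb' x) (hQ x) (hQt x) T).trans ?_
        rw [Matrix.mul_add, Matrix.trace_add, Matrix.mul_smul, Matrix.mul_one,
          Matrix.trace_smul, smul_eq_mul]
        gcongr
        exact hQt x
    _ = Fintype.card m * (b + η) ^ (2 * T + 1) +
          (b + 2 * η) ^ (2 * T) * ((𝔼 x, (Q x * F x).trace + 2 * η * t) / t) := by
        simp only [Finset.expect_add_distrib, ← Finset.mul_expect, ← Finset.expect_div,
          Fintype.expect_const]
    _ ≤ Fintype.card m * (b + η) ^ (2 * T + 1) +
          (b + 2 * η) ^ (2 * T) * ((-(4 * t * η) + 2 * η * t) / t) := by gcongr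
    _ = Fintype.card m * (b + η) ^ (2 * T + 1) - 2 * η * (b + 2 * η) ^ (2 * T) := by
        field_simp
        ring
    _ < 0 := sub_neg.mpr hT

end Spectral

section Planting

variable {ι κ : Type*} [DecidableEq κ]

/-- The point of the cube on `ι × κ` that agrees with `y` along the graph of `S` and with `z`
elsewhere. -/
def plant (S : ι → κ) (z : ι × κ → Bool) (y : ι → Bool) : ι × κ → Bool :=
  fun p => if p.2 = S p.1 then y p.1 else z p

/-- The restriction of a point of the cube on `ι × κ` to the graph of `S`. -/
def alongGraph (S : ι → κ) (x : ι × κ → Bool) : ι → Bool :=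
  fun i => x (i, S i)

/-- The number of points of `A` on the graph of `S`. -/
def meetCard (S : ι → κ) (A : Finset (ι × κ)) : ℕ :=
  (A.filter fun p => p.2 = S p.1).card

theorem alongGraph_plant (S : ι → κ) (z : ι × κ → Bool) (y : ι → Bool) :
    alongGraph S (plant S z y) = y := by
  ext i
  simp [alongGraph, plant]

theorem plant_plant_alongGraph (S : ι → κ) (z : ι × κ → Bool) (y : ι → Bool) :
    plant S (plant S z y) (alongGraph S z) = z := by
  ext ⟨i, j⟩
  by_cases h : j = S i <;> simp [plant, alongGraph, h]

theorem walsh_plant_mem_lowDegree {h : ℕ} (S : ι → κ) (z : ι × κ → Bool)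
    {A : Finset (ι × κ)} (hA : meetCard S A ≤ h) :
    (fun y => walsh A (plant S z y)) ∈ lowDegree ι h := by
  have heq : (fun y => walsh A (plant S z y)) =
      walsh (A.filter fun p => ¬ p.2 = S p.1) z •
        ∏ p ∈ A.filter (fun p => p.2 = S p.1), fun y : ι → Bool => 1 - 2 * bitVal (y p.1) := by
    ext y
    rw [Pi.smul_apply, Finset.prod_apply, smul_eq_mul, walsh, walsh,
      ← Finset.prod_filter_mul_prod_filter_not A (fun p => p.2 = S p.1), mul_comm]
    congr 1 <;> refine Finset.prod_congr rfl fun p hp => ?_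
    · rw [plant, if_neg (Finset.mem_filter.mp hp).2]
    · rw [plant, if_pos (Finset.mem_filter.mp hp).2]
  rw [heq]
  refine Submodule.smul_mem _ _ (lowDegree_mono hA ?_)
  simpa only [meetCard, Finset.sum_const, smul_eq_mul, mul_one] using
    prod_mem_lowDegree (s := A.filter fun p => p.2 = S p.1) fun p _ =>
      bit_mem_lowDegree p.1 fun b => 1 - 2 * bitVal b

variable [Fintype ι] [Fintype κ] [DecidableEq ι]

theorem expect_plant (S : ι → κ) (φ : (ι × κ → Bool) → ℝ) :
    𝔼 z, 𝔼 y, φ (plant S z y) = 𝔼 x, φ x := by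
  have hinv : Function.Involutive fun zy : (ι × κ → Bool) × (ι → Bool) =>
      (plant S zy.1 zy.2, alongGraph S zy.1) := by
    rintro ⟨z, y⟩
    simp only [plant_plant_alongGraph, alongGraph_plant]
  calc 𝔼 z, 𝔼 y, φ (plant S z y)
      = 𝔼 zy : (ι × κ → Bool) × (ι → Bool), φ (plant S zy.1 zy.2) := by
        rw [← Finset.univ_product_univ, Finset.expect_product]
    _ = 𝔼 zy : (ι × κ → Bool) × (ι → Bool), φ zy.1 :=
        Fintype.expect_equiv hinv.toPerm _ _ fun _ => rfl
    _ = 𝔼 x, φ x := by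
        rw [← Finset.univ_product_univ, Finset.expect_product]
        simp only [Fintype.expect_const]

theorem expect_alongGraph (S : ι → κ) (φ : (ι → Bool) → ℝ) :
    𝔼 x, φ (alongGraph S x) = 𝔼 y, φ y := by
  rw [← expect_plant S]
  simp only [alongGraph_plant, Fintype.expect_const]

theorem card_graph_superset_mul_le (E : Finset (ι × κ)) :
    (Finset.univ.filter fun S : ι → κ => ∀ p ∈ E, p.2 = S p.1).card * Fintype.card κ ^ E.card ≤
      Fintype.card κ ^ Fintype.card ι := by
  set G := Finset.univ.filter fun S : ι → κ => ∀ p ∈ E, p.2 = S p.1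
  have hG {S} (hS : S ∈ G) : ∀ p ∈ E, p.2 = S p.1 := (Finset.mem_filter.mp hS).2
  obtain hempty | ⟨S₀, hS₀⟩ := G.eq_empty_or_nonempty
  · simp only [hempty, Finset.card_empty, zero_mul, zero_le]
  have hcard : (E.image Prod.fst).card = E.card := Finset.card_image_of_injOn fun p hp p' hp' h =>
    Prod.ext h (by rw [hG hS₀ p hp, hG hS₀ p' hp', h])
  have hsub : G ⊆ Fintype.piFinset fun i => if i ∈ E.image Prod.fst then {S₀ i} else .univ := by
    intro S hS
    refine Fintype.mem_piFinset.mpr fun i => ?_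
    split_ifs with hi
    · obtain ⟨p, hp, rfl⟩ := Finset.mem_image.mp hi
      rw [Finset.mem_singleton, ← hG hS p hp, hG hS₀ p hp]
    · exact Finset.mem_univ _
  have hGcard : G.card ≤ Fintype.card κ ^ (E.image Prod.fst)ᶜ.card := by
    refine (Finset.card_le_card hsub).trans_eq ?_
    simp only [Fintype.card_piFinset, apply_ite Finset.card, Finset.card_singleton,
      Finset.card_univ, Finset.prod_ite, Finset.prod_const_one, one_mul, Finset.prod_const,
      Finset.filter_not, Finset.filter_univ_mem, Finset.compl_eq_univ_sdiff]
  calc G.card * Fintype.card κ ^ E.card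
      ≤ Fintype.card κ ^ (E.image Prod.fst)ᶜ.card * Fintype.card κ ^ (E.image Prod.fst).card := by
        rw [hcard]
        exact Nat.mul_le_mul_right _ hGcard
    _ = Fintype.card κ ^ Fintype.card ι := by rw [← pow_add, add_comm, Finset.card_add_card_compl]

theorem card_le_meetCard_mul_le (A : Finset (ι × κ)) (m : ℕ) :
    (Finset.univ.filter fun S : ι → κ => m ≤ meetCard S A).card * Fintype.card κ ^ m ≤
      A.card ^ m * Fintype.card κ ^ Fintype.card ι := by
  have hsub : (Finset.univ.filter fun S : ι → κ => m ≤ meetCard S A) ⊆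
      (A.powersetCard m).biUnion fun E =>
        Finset.univ.filter fun S : ι → κ => ∀ p ∈ E, p.2 = S p.1 := by
    intro S hS
    obtain ⟨E, hE, hEcard⟩ := Finset.exists_subset_card_eq (Finset.mem_filter.mp hS).2
    simp only [Finset.mem_biUnion, Finset.mem_powersetCard, Finset.mem_filter, Finset.mem_univ,
      true_and]
    exact ⟨E, ⟨hE.trans (Finset.filter_subset _ _), hEcard⟩,
      fun p hp => (Finset.mem_filter.mp (hE hp)).2⟩
  calc _ ≤ (∑ E ∈ A.powersetCard m,
        (Finset.univ.filter fun S : ι → κ => ∀ p ∈ E, p.2 = S p.1).card) * Fintype.card κ ^ m :=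
        Nat.mul_le_mul_right _ ((Finset.card_le_card hsub).trans Finset.card_biUnion_le)
    _ ≤ ∑ _ ∈ A.powersetCard m, Fintype.card κ ^ Fintype.card ι := by
        rw [Finset.sum_mul]
        refine Finset.sum_le_sum fun E hE => ?_
        simpa only [(Finset.mem_powersetCard.mp hE).2] using card_graph_superset_mul_le E
    _ = A.card.choose m * Fintype.card κ ^ Fintype.card ι := by
        rw [Finset.sum_const, Finset.card_powersetCard, smul_eq_mul]
    _ ≤ _ := Nat.mul_le_mul_right _ (Nat.choose_le_pow _ _)

theorem expect_ite_le_meetCard_le [Nonempty κ] (A : Finset (ι × κ)) (m : ℕ) :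
    𝔼 S : ι → κ, (if m ≤ meetCard S A then (1 : ℝ) else 0) ≤ (A.card / Fintype.card κ) ^ m := by
  have : (0 : ℝ) < Fintype.card κ := by exact_mod_cast Fintype.card_pos
  rw [Fintype.expect_eq_sum_div_card, Finset.sum_boole, Fintype.card_fun, Nat.cast_pow, div_pow,
    div_le_div_iff₀ (by positivity) (by positivity)]
  exact_mod_cast card_le_meetCard_mul_le A m

end Planting

section RandomRestriction

variable {ι κ : Type*} [Fintype ι] [Fintype κ] [DecidableEq ι] [DecidableEq κ]

/-- The sets with at most `h` points on the graph of `S`: the frequencies whose Walsh functions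
have degree at most `h` along that graph. -/
def lightSets (S : ι → κ) (h : ℕ) : Finset (Finset (ι × κ)) :=
  Finset.univ.filter fun A => meetCard S A ≤ h

theorem walshPart_lightSets_plant_mem_lowDegree (S : ι → κ) (h : ℕ) (f : (ι × κ → Bool) → ℝ)
    (z : ι × κ → Bool) :
    (fun y => walshPart (lightSets S h) f (plant S z y)) ∈ lowDegree ι h := by
  have heq : (fun y => walshPart (lightSets S h) f (plant S z y)) =
      ∑ A ∈ lightSets S h, walshCoeff A f • fun y => walsh A (plant S z y) := by
    ext y
    simp only [walshPart_apply, Finset.sum_apply, Pi.smul_apply]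
  rw [heq]
  exact Submodule.sum_mem _ fun A hA => Submodule.smul_mem _ _ <|
    walsh_plant_mem_lowDegree S z (Finset.mem_filter.mp hA).2

theorem expect_mul_walshPart_lightSets_sq_nonneg {D : (ι → Bool) → ℝ} {h : ℕ}
    (hD : IsPseudoPositive h D) (S : ι → κ) (f : (ι × κ → Bool) → ℝ) :
    0 ≤ 𝔼 x, D (alongGraph S x) * walshPart (lightSets S h) f x ^ 2 := by
  rw [← expect_plant S]
  simp only [alongGraph_plant]
  exact Finset.expect_nonneg fun z _ => hD _ (walshPart_lightSets_plant_mem_lowDegree S h f z)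

theorem expect_walshPart_compl_lightSets_sq_le [Nonempty κ] {f : (ι × κ → Bool) → ℝ} {l : ℕ}
    (hf : f ∈ lowDegree (ι × κ) l) (h : ℕ) :
    𝔼 S : ι → κ, 𝔼 x, walshPart (lightSets S h)ᶜ f x ^ 2 ≤
      (l / Fintype.card κ) ^ (h + 1) * 𝔼 x, f x ^ 2 := by
  have hlight (S : ι → κ) : ∑ A ∈ (lightSets S h)ᶜ, walshCoeff A f ^ 2 =
      ∑ A, walshCoeff A f ^ 2 * if h + 1 ≤ meetCard S A then 1 else 0 := by
    simp only [lightSets, Finset.compl_filter, not_le, Finset.sum_filter, Nat.succ_le_iff,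
      mul_ite, mul_one, mul_zero]
  simp only [expect_walshPart_sq, hlight, expect_sq_eq_sum_walshCoeff_sq f]
  rw [Finset.expect_sum_comm, Finset.mul_sum]
  refine Finset.sum_le_sum fun A _ => ?_
  rw [← Finset.mul_expect, mul_comm]
  rcases lt_or_ge l A.card with hA | hA
  · simp only [walshCoeff_eq_zero hf hA, zero_pow two_ne_zero, mul_zero, le_refl]
  · refine mul_le_mul_of_nonneg_right ((expect_ite_le_meetCard_le A (h + 1)).trans ?_)
      (sq_nonneg _)
    gcongr

theorem mul_sq_add_ge {D B θ a b : ℝ} (hD : |D| ≤ B) (hθ : 0 < θ) :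
    D * a ^ 2 - B * (θ * (a + b) ^ 2 + (1 / θ + 1) * b ^ 2) ≤ D * (a + b) ^ 2 := by
  have hcross : |2 * (a + b) * b - b ^ 2| ≤ θ * (a + b) ^ 2 + (1 / θ + 1) * b ^ 2 := by
    have hamgm (u : ℝ) (hu : u ^ 2 = 1) : 2 * u * ((a + b) * b) ≤
        θ * (a + b) ^ 2 + 1 / θ * b ^ 2 := by
      rw [← sub_nonneg]
      have : θ * (a + b) ^ 2 + 1 / θ * b ^ 2 - 2 * u * ((a + b) * b) =
          (θ * (a + b) - u * b) ^ 2 / θ := by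
        field_simp
        linear_combination (-b ^ 2) * hu
      rw [this]
      positivity
    rw [abs_le]
    constructor <;> nlinarith [sq_nonneg b, hamgm 1 (by norm_num), hamgm (-1) (by norm_num)]
  have hle : |D * (2 * (a + b) * b - b ^ 2)| ≤ B * (θ * (a + b) ^ 2 + (1 / θ + 1) * b ^ 2) := by
    rw [abs_mul]
    exact mul_le_mul hD hcross (abs_nonneg _) ((abs_nonneg D).trans hD)
  linarith [(abs_le.mp hle).1]

theorem expect_mul_sq_ge {D : (ι → Bool) → ℝ} {B θ : ℝ} {h : ℕ} (hDB : ∀ y, |D y| ≤ B)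
    (hD : IsPseudoPositive h D) (hθ : 0 < θ) (S : ι → κ) (f : (ι × κ → Bool) → ℝ) :
    -(B * (θ * 𝔼 x, f x ^ 2 + (1 / θ + 1) * 𝔼 x, walshPart (lightSets S h)ᶜ f x ^ 2)) ≤
      𝔼 x, D (alongGraph S x) * f x ^ 2 := by
  have hpoint (x) : D (alongGraph S x) * walshPart (lightSets S h) f x ^ 2 -
      B * (θ * f x ^ 2 + (1 / θ + 1) * walshPart (lightSets S h)ᶜ f x ^ 2) ≤
      D (alongGraph S x) * f x ^ 2 := by
    rw [← congrFun (walshPart_add_walshPart_compl (lightSets S h) f) x]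
    exact mul_sq_add_ge (hDB _) hθ
  have hsum := Finset.expect_le_expect fun x (_ : x ∈ Finset.univ) => hpoint x
  simp only [Finset.expect_sub_distrib, ← Finset.mul_expect, Finset.expect_add_distrib] at hsum
  linarith [expect_mul_walshPart_lightSets_sq_nonneg hD S f]

end RandomRestriction

theorem matrix_pow_apply_mem_lowDegree {ι m : Type*} [Fintype m] [DecidableEq m]
    {G : (ι → Bool) → Matrix m m ℝ} {e : ℕ}
    (hG : ∀ i j, (fun x => G x i j) ∈ lowDegree ι e) (T : ℕ) (i j : m) :
    (fun x => (G x ^ T) i j) ∈ lowDegree ι (e * T) := by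
  classical
  induction T generalizing i j with
  | zero =>
    simp only [pow_zero]
    exact const_mem_lowDegree _ _
  | succ T ih =>
    have hsum : (fun x => (G x ^ (T + 1)) i j) =
        ∑ k, (fun x => (G x ^ T) i k) * fun x => G x k j := by
      ext x
      simp only [pow_succ, Matrix.mul_apply, Finset.sum_apply, Pi.mul_apply]
    rw [hsum]
    exact Submodule.sum_mem _ fun k _ => mul_mem_lowDegree (ih i k) (hG k j)

section MatrixPolynomial

variable {ι κ m : Type*} [Fintype ι] [Fintype κ] [DecidableEq ι] [DecidableEq κ] [Fintype m]

theorem trace_transpose_mul_self (H : Matrix m m ℝ) :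
    (H.transpose * H).trace = ∑ i, ∑ j, H i j ^ 2 := by
  simp only [Matrix.trace, Matrix.diag_apply, Matrix.mul_apply, Matrix.transpose_apply, ← sq]
  exact Finset.sum_comm

theorem trace_transpose_mul_transpose_mul_self_mul (C R : Matrix m m ℝ) :
    (R.transpose * (C.transpose * C) * R).trace = ∑ i, ∑ j, (C * R) i j ^ 2 := by
  rw [← trace_transpose_mul_self, Matrix.transpose_mul]
  simp only [Matrix.mul_assoc]

theorem sum_mul_apply_sq_le (C H : Matrix m m ℝ) :
    ∑ i, ∑ j, (C * H) i j ^ 2 ≤ (C.transpose * C).trace * (H.transpose * H).trace := by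
  rw [trace_transpose_mul_self, trace_transpose_mul_self,
    Finset.sum_comm (f := fun i j => H i j ^ 2), Finset.sum_mul_sum]
  refine Finset.sum_le_sum fun i _ => Finset.sum_le_sum fun j _ => ?_
  rw [Matrix.mul_apply]
  exact Finset.sum_mul_sq_le_sq_mul_sq _ _ _

/-- `walshPart` applied to every entry of a matrix-valued function on the cube. -/
noncomputable def matrixWalshPart (𝒜 : Finset (Finset ι)) (R : (ι → Bool) → Matrix m m ℝ)
    (x : ι → Bool) : Matrix m m ℝ :=
  Matrix.of fun i j => walshPart 𝒜 (fun x => R x i j) x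

theorem walshPart_mul_apply (𝒜 : Finset (Finset ι)) (C : Matrix m m ℝ)
    (R : (ι → Bool) → Matrix m m ℝ) (i j : m) (x : ι → Bool) :
    walshPart 𝒜 (fun x => (C * R x) i j) x = (C * matrixWalshPart 𝒜 R x) i j := by
  have hsum : (fun x => (C * R x) i j) = ∑ k, C i k • fun x => R x k j := by
    ext x
    simp only [Matrix.mul_apply, Finset.sum_apply, Pi.smul_apply, smul_eq_mul]
  rw [hsum, Matrix.mul_apply]
  simp only [map_sum, map_smul, Finset.sum_apply, Pi.smul_apply, smul_eq_mul, matrixWalshPart,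
    Matrix.of_apply]

theorem expect_trace_matrixWalshPart_compl_lightSets_le [Nonempty κ]
    {R : (ι × κ → Bool) → Matrix m m ℝ} {l : ℕ}
    (hR : ∀ i j, (fun x => R x i j) ∈ lowDegree (ι × κ) l) (h : ℕ) :
    𝔼 S : ι → κ, 𝔼 x, ((matrixWalshPart (lightSets S h)ᶜ R x).transpose *
        matrixWalshPart (lightSets S h)ᶜ R x).trace ≤
      (l / Fintype.card κ) ^ (h + 1) * 𝔼 x, ((R x).transpose * R x).trace := by
  simp only [trace_transpose_mul_self, Finset.expect_sum_comm, Finset.mul_sum]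
  exact Finset.sum_le_sum fun i _ => Finset.sum_le_sum fun j _ =>
    expect_walshPart_compl_lightSets_sq_le (hR i j) h

theorem expect_mul_trace_ge {D : (ι → Bool) → ℝ} {B τ θ : ℝ} {h : ℕ} (hDB : ∀ y, |D y| ≤ B)
    (hD : IsPseudoPositive h D) (hθ : 0 < θ) (S : ι → κ) {P : Matrix m m ℝ}
    (hP : P.PosSemidef) (hτ : P.trace ≤ τ) (R : (ι × κ → Bool) → Matrix m m ℝ) :
    -(B * (θ * 𝔼 x, ((R x).transpose * P * R x).trace +
        (1 / θ + 1) * (τ * 𝔼 x, ((matrixWalshPart (lightSets S h)ᶜ R x).transpose *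
          matrixWalshPart (lightSets S h)ᶜ R x).trace))) ≤
      𝔼 x, D (alongGraph S x) * ((R x).transpose * P * R x).trace := by
  obtain ⟨C, rfl⟩ := exists_eq_transpose_mul_self hP
  have hB : 0 ≤ B := (abs_nonneg _).trans (hDB fun _ => false)
  have hheavy : 𝔼 x, ∑ i, ∑ j, (C * matrixWalshPart (lightSets S h)ᶜ R x) i j ^ 2 ≤
      τ * 𝔼 x, ((matrixWalshPart (lightSets S h)ᶜ R x).transpose *
          matrixWalshPart (lightSets S h)ᶜ R x).trace := by
    rw [Finset.mul_expect]
    refine Finset.expect_le_expect fun x _ => (sum_mul_apply_sq_le _ _).trans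
      (mul_le_mul_of_nonneg_right hτ ?_)
    rw [trace_transpose_mul_self]
    positivity
  have hentry := Finset.sum_le_sum fun i (_ : i ∈ Finset.univ) =>
    Finset.sum_le_sum fun j (_ : j ∈ Finset.univ) =>
      expect_mul_sq_ge hDB hD hθ S fun x => (C * R x) i j
  simp only [walshPart_mul_apply, Finset.sum_neg_distrib, ← Finset.mul_sum,
    Finset.sum_add_distrib, ← Finset.expect_sum_comm] at hentry
  simp only [trace_transpose_mul_transpose_mul_self_mul]
  refine le_trans (neg_le_neg ?_) hentry
  gcongr

variable [DecidableEq m]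

theorem expect_trace_transpose_mul_mul_le {P : (ι → κ) → Matrix m m ℝ}
    (hP : (1 - 𝔼 S, P S).PosSemidef) (R : (ι × κ → Bool) → Matrix m m ℝ) :
    𝔼 S, 𝔼 x, ((R x).transpose * P S * R x).trace ≤ 𝔼 x, ((R x).transpose * R x).trace := by
  rw [Finset.expect_comm]
  refine Finset.expect_le_expect fun x _ => ?_
  have hcycle (A : Matrix m m ℝ) :
      ((R x).transpose * A * R x).trace = (A * (R x * (R x).transpose)).trace := by
    rw [Matrix.mul_assoc, Matrix.trace_mul_comm, Matrix.mul_assoc]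
  rw [Finset.expect_congr rfl fun S _ => hcycle (P S), ← trace_expect_mul]
  refine (trace_mul_le_of_posSemidef_sub hP ?_).trans_eq ?_
  · simpa using Matrix.posSemidef_self_mul_conjTranspose (R x)
  · rw [Matrix.one_mul, Matrix.trace_mul_comm]

/-- A matrix polynomial of degree far below `Fintype.card κ` has low degree along most graphs. -/
theorem expect_expect_mul_trace_ge [Nonempty κ] {D : (ι → Bool) → ℝ} {B τ θ : ℝ} {h l : ℕ}
    (hDB : ∀ y, |D y| ≤ B) (hD : IsPseudoPositive h D) (hθ : 0 < θ)
    {P : (ι → κ) → Matrix m m ℝ} (hP : ∀ S, (P S).PosSemidef)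
    (hP1 : (1 - 𝔼 S, P S).PosSemidef) (hτ : ∀ S, (P S).trace ≤ τ)
    {R : (ι × κ → Bool) → Matrix m m ℝ}
    (hR : ∀ i j, (fun x => R x i j) ∈ lowDegree (ι × κ) l) :
    -(B * (θ + (1 / θ + 1) * (τ * (l / Fintype.card κ) ^ (h + 1))) *
        𝔼 x, ((R x).transpose * R x).trace) ≤
      𝔼 S, 𝔼 x, D (alongGraph S x) * ((R x).transpose * P S * R x).trace := by
  have hB : 0 ≤ B := (abs_nonneg _).trans (hDB fun _ => false)
  have hτ0 : 0 ≤ τ := (hP fun _ => Classical.arbitrary κ).trace_nonneg.trans (hτ _)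
  have hlower := Finset.expect_le_expect fun S (_ : S ∈ Finset.univ) =>
    expect_mul_trace_ge hDB hD hθ S (hP S) (hτ S) R
  simp only [Finset.expect_neg_distrib, ← Finset.mul_expect, Finset.expect_add_distrib] at hlower
  refine le_trans (neg_le_neg ?_) hlower
  calc B * (θ * 𝔼 S, 𝔼 x, ((R x).transpose * P S * R x).trace +
        (1 / θ + 1) * (τ * 𝔼 S : ι → κ, 𝔼 x, ((matrixWalshPart (lightSets S h)ᶜ R x).transpose *
          matrixWalshPart (lightSets S h)ᶜ R x).trace))
      ≤ B * (θ * 𝔼 x, ((R x).transpose * R x).trace + (1 / θ + 1) * (τ *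
        ((l / Fintype.card κ) ^ (h + 1) * 𝔼 x, ((R x).transpose * R x).trace))) := by
        gcongr
        · exact expect_trace_transpose_mul_mul_le hP1 R
        · exact expect_trace_matrixWalshPart_compl_lightSets_le hR h
    _ = _ := by ring

end MatrixPolynomial

section PlantedOperator

variable {ι κ m : Type*} [Fintype ι] [Fintype κ] [DecidableEq ι]

/-- The average of the matrices `P S`, weighted by the values of `D` on the restrictions of `x` to
the graphs of `S`. -/
noncomputable def plantedOperator (D : (ι → Bool) → ℝ) (P : (ι → κ) → Matrix m m ℝ)
    (x : ι × κ → Bool) : Matrix m m ℝ :=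
  𝔼 S, D (alongGraph S x) • P S

theorem plantedOperator_apply (D : (ι → Bool) → ℝ) (P : (ι → κ) → Matrix m m ℝ)
    (x : ι × κ → Bool) (i j : m) :
    plantedOperator D P x i j = 𝔼 S, D (alongGraph S x) * P S i j :=
  map_expect (Matrix.entryLinearMap ℚ≥0 ℝ i j) _ _

theorem plantedOperator_neg (D : (ι → Bool) → ℝ) (P : (ι → κ) → Matrix m m ℝ)
    (x : ι × κ → Bool) : plantedOperator (-D) P x = -plantedOperator D P x := by
  simp only [plantedOperator, Pi.neg_apply, neg_smul, Finset.expect_neg_distrib]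

theorem plantedOperator_apply_mem_lowDegree (D : (ι → Bool) → ℝ) (P : (ι → κ) → Matrix m m ℝ)
    (i j : m) : (fun x => plantedOperator D P x i j) ∈ lowDegree (ι × κ) (Fintype.card ι) := by
  have hexpect : (fun x => plantedOperator D P x i j) =
      𝔼 S, P S i j • fun x : ι × κ → Bool => D (alongGraph S x) := by
    ext x
    simp only [plantedOperator_apply, Finset.expect_apply, Pi.smul_apply, smul_eq_mul, mul_comm]
  rw [hexpect]
  exact Submodule.smul_of_tower_mem _ _ <| Submodule.sum_mem _ fun S _ =>
    Submodule.smul_mem _ _ (comp_mem_lowDegree D fun i => (i, S i))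

theorem isHermitian_plantedOperator (D : (ι → Bool) → ℝ) {P : (ι → κ) → Matrix m m ℝ}
    (hP : ∀ S, (P S).PosSemidef) (x : ι × κ → Bool) : (plantedOperator D P x).IsHermitian := by
  ext i j
  have hS (S) : P S j i = P S i j := (hP S).isHermitian.apply i j
  simp only [Matrix.conjTranspose_apply, plantedOperator_apply, hS, star_trivial]

theorem posSemidef_smul_one_sub_plantedOperator [Finite m] [DecidableEq m] {D : (ι → Bool) → ℝ}
    {B : ℝ} (hB : 0 ≤ B) (hDB : ∀ y, D y ≤ B) {P : (ι → κ) → Matrix m m ℝ}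
    (hP : ∀ S, (P S).PosSemidef) (hP1 : (1 - 𝔼 S, P S).PosSemidef) (x : ι × κ → Bool) :
    (B • 1 - plantedOperator D P x).PosSemidef := by
  have hsplit : B • 1 - plantedOperator D P x =
      B • (1 - 𝔼 S, P S) + 𝔼 S, (B - D (alongGraph S x)) • P S := by
    simp only [plantedOperator, sub_smul, smul_sub, Finset.expect_sub_distrib,
      Finset.smul_expect]
    abel
  rw [hsplit]
  exact (hP1.smul hB).add (posSemidef_expect _ fun S _ => (hP S).smul (sub_nonneg.mpr (hDB _)))

variable [Fintype m]

theorem trace_mul_plantedOperator (A : Matrix m m ℝ) (D : (ι → Bool) → ℝ)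
    (P : (ι → κ) → Matrix m m ℝ) (x : ι × κ → Bool) :
    (A * plantedOperator D P x).trace = 𝔼 S, D (alongGraph S x) * (A * P S).trace := by
  simp only [plantedOperator, trace_mul_expect, Matrix.mul_smul, Matrix.trace_smul, smul_eq_mul]

variable [DecidableEq κ] [DecidableEq m]

theorem expect_trace_pow_mul_plantedOperator_ge [Nonempty κ] {D : (ι → Bool) → ℝ} {B τ θ : ℝ}
    {h : ℕ} (hDB : ∀ y, |D y| ≤ B) (hD : IsPseudoPositive h D) (hθ : 0 < θ)
    {P : (ι → κ) → Matrix m m ℝ} (hP : ∀ S, (P S).PosSemidef)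
    (hP1 : (1 - 𝔼 S, P S).PosSemidef) (hτ : ∀ S, (P S).trace ≤ τ) (T : ℕ) :
    -(B * (θ + (1 / θ + 1) * (τ * ((Fintype.card ι * T : ℕ) / Fintype.card κ) ^ (h + 1))) *
        𝔼 x, ((B • 1 - plantedOperator D P x) ^ (2 * T)).trace) ≤
      𝔼 x, ((B • 1 - plantedOperator D P x) ^ (2 * T) * plantedOperator D P x).trace := by
  have hsymm (x) : ((B • 1 - plantedOperator D P x) ^ T).transpose =
      (B • 1 - plantedOperator D P x) ^ T := by
    rw [Matrix.transpose_pow, Matrix.transpose_sub, Matrix.transpose_smul, Matrix.transpose_one,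
      ← Matrix.conjTranspose_eq_transpose_of_trivial (plantedOperator D P x),
      isHermitian_plantedOperator D hP x]
  have hdeg : ∀ i j, (fun x => ((B • 1 - plantedOperator D P x) ^ T) i j) ∈
      lowDegree (ι × κ) (Fintype.card ι * T) :=
    matrix_pow_apply_mem_lowDegree (fun i j => Submodule.sub_mem _ (const_mem_lowDegree _ _)
      (plantedOperator_apply_mem_lowDegree D P i j)) T
  have hge := expect_expect_mul_trace_ge hDB hD hθ hP hP1 hτ hdeg
  have hcycle (x S) : ((B • 1 - plantedOperator D P x) ^ T * P S *
      (B • 1 - plantedOperator D P x) ^ T).trace =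
      ((B • 1 - plantedOperator D P x) ^ (2 * T) * P S).trace := by
    rw [Matrix.trace_mul_cycle, two_mul, pow_add]
  rw [Finset.expect_comm] at hge
  simpa only [hsymm, hcycle, ← trace_mul_plantedOperator, ← pow_add, ← two_mul] using hge

theorem neg_lt_expect_trace_mul_plantedOperator [Nonempty κ] {D : (ι → Bool) → ℝ}
    {B τ θ η t : ℝ} {h T : ℕ} (hDB : ∀ y, |D y| ≤ B) (hD : IsPseudoPositive h D) (hθ : 0 < θ)
    (hη : 0 < η) (ht : 0 < t) {P : (ι → κ) → Matrix m m ℝ} {Q : (ι × κ → Bool) → Matrix m m ℝ}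
    (hP : ∀ S, (P S).PosSemidef) (hP1 : (1 - 𝔼 S, P S).PosSemidef) (hτ : ∀ S, (P S).trace ≤ τ)
    (hQ : ∀ x, (Q x).PosSemidef) (hQt : ∀ x, (Q x).trace ≤ t)
    (hT : Fintype.card m * (B + η) ^ (2 * T + 1) < 2 * η * (B + 2 * η) ^ (2 * T))
    (hsmall : B * (θ + (1 / θ + 1) *
      (τ * ((Fintype.card ι * T : ℕ) / Fintype.card κ) ^ (h + 1))) ≤ η) :
    -(4 * t * η) < 𝔼 x, (Q x * plantedOperator D P x).trace := by
  by_contra! hneg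
  have hB : 0 ≤ B := (abs_nonneg _).trans (hDB fun _ => false)
  have hsub := posSemidef_smul_one_sub_plantedOperator hB (fun y => (abs_le.mp (hDB y)).2) hP hP1
  have hadd (x) : (B • 1 + plantedOperator D P x).PosSemidef := by
    simpa only [plantedOperator_neg, sub_neg_eq_add] using
      posSemidef_smul_one_sub_plantedOperator (D := -D) hB
        (fun y => neg_le.mp (abs_le.mp (hDB y)).1) hP hP1 x
  have hupper := expect_trace_pow_shift_mul_neg hη ht (isHermitian_plantedOperator D hP) hsub hadd
    hQ hQt hneg hT
  simp only [Matrix.mul_add, Matrix.trace_add, Matrix.mul_smul, Matrix.mul_one,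
    Matrix.trace_smul, smul_eq_mul, Finset.expect_add_distrib, ← Finset.mul_expect] at hupper
  have hlower := expect_trace_pow_mul_plantedOperator_ge hDB hD hθ hP hP1 hτ T
  have hweight : 0 ≤ 𝔼 x, ((B • 1 - plantedOperator D P x) ^ (2 * T)).trace :=
    Finset.expect_nonneg fun x _ => ((hsub x).pow _).trace_nonneg
  linarith [mul_le_mul_of_nonneg_right hsmall hweight]

end PlantedOperator

section Truncation

variable {m : Type*} [Fintype m]

/-- The matrix `A` if its trace is at most `τ`, and zero otherwise. -/
noncomputable def truncateTrace (τ : ℝ) (A : Matrix m m ℝ) : Matrix m m ℝ :=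
  if A.trace ≤ τ then A else 0

theorem trace_truncateTrace_le {τ : ℝ} (hτ : 0 ≤ τ) (A : Matrix m m ℝ) :
    (truncateTrace τ A).trace ≤ τ := by
  rw [truncateTrace]
  split_ifs with h
  · exact h
  · rwa [Matrix.trace_zero]

theorem posSemidef_truncateTrace (τ : ℝ) {A : Matrix m m ℝ} (hA : A.PosSemidef) :
    (truncateTrace τ A).PosSemidef := by
  rw [truncateTrace]
  split_ifs
  exacts [hA, Matrix.PosSemidef.zero]

theorem posSemidef_sub_truncateTrace (τ : ℝ) {A : Matrix m m ℝ} (hA : A.PosSemidef) :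
    (A - truncateTrace τ A).PosSemidef := by
  rw [truncateTrace]
  split_ifs
  · simpa only [sub_self] using Matrix.PosSemidef.zero
  · rwa [sub_zero]

variable [DecidableEq m] {σ : Type*} [Fintype σ] {P : σ → Matrix m m ℝ}

theorem posSemidef_one_sub_expect_truncateTrace (hP : ∀ S, (P S).PosSemidef)
    (hP1 : (1 - 𝔼 S, P S).PosSemidef) (τ : ℝ) :
    (1 - 𝔼 S, truncateTrace τ (P S)).PosSemidef := by
  have hsplit : 1 - 𝔼 S, truncateTrace τ (P S) =
      (1 - 𝔼 S, P S) + 𝔼 S, (P S - truncateTrace τ (P S)) := by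
    rw [Finset.expect_sub_distrib, sub_add_sub_cancel]
  rw [hsplit]
  exact hP1.add (posSemidef_expect _ fun S _ => posSemidef_sub_truncateTrace τ (hP S))

theorem expect_ite_lt_trace_mul_le (hP : ∀ S, (P S).PosSemidef)
    (hP1 : (1 - 𝔼 S, P S).PosSemidef) (τ : ℝ) :
    (𝔼 S, if τ < (P S).trace then (1 : ℝ) else 0) * τ ≤ Fintype.card m := by
  have htrace : 𝔼 S, (P S).trace ≤ Fintype.card m := by
    have h := hP1.trace_nonneg
    rwa [Matrix.trace_sub, Matrix.trace_one, ← Matrix.one_mul (𝔼 S, P S), trace_mul_expect,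
      sub_nonneg, Finset.expect_congr rfl fun S _ => by rw [Matrix.one_mul]] at h
  rw [Finset.expect_mul]
  refine (Finset.expect_le_expect fun S _ => ?_).trans htrace
  split_ifs with h
  · rw [one_mul]
    exact h.le
  · rw [zero_mul]
    exact (hP S).trace_nonneg

end Truncation

section Factorization

variable {ι κ m : Type*} [Fintype ι] [Fintype κ] [DecidableEq ι] [Fintype m]

theorem mul_trace_truncateTrace_le {P Q : Matrix m m ℝ} (hP : P.PosSemidef) (hQ : Q.PosSemidef)
    {t D B : ℝ} (hPQ : (P * Q).trace ≤ t) (hD : |D| ≤ B) (τ : ℝ) :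
    D * (truncateTrace τ P * Q).trace ≤
      D * (P * Q).trace + B * t * if τ < P.trace then 1 else 0 := by
  have hle : |D * (P * Q).trace| ≤ B * t := by
    rw [abs_mul, abs_of_nonneg (trace_mul_nonneg hP hQ)]
    exact mul_le_mul hD hPQ (trace_mul_nonneg hP hQ) ((abs_nonneg _).trans hD)
  rcases lt_or_ge τ P.trace with hτ | hτ
  · rw [truncateTrace, if_neg hτ.not_ge, if_pos hτ, Matrix.zero_mul, Matrix.trace_zero, mul_zero,
      mul_one]
    linarith [(abs_le.mp hle).1]
  · rw [truncateTrace, if_pos hτ, if_neg hτ.not_gt, mul_zero, add_zero]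

variable [DecidableEq κ] [Nonempty κ] [Nonempty m]

theorem neg_lt_expect_mul_trace {D : (ι → Bool) → ℝ} {B θ η t : ℝ} {h T : ℕ} (hB : 0 < B)
    (hDB : ∀ y, |D y| ≤ B) (hD : IsPseudoPositive h D) (hθ : 0 < θ) (hη : 0 < η) (ht : 0 ≤ t)
    {P : (ι → κ) → Matrix m m ℝ} {Q : (ι × κ → Bool) → Matrix m m ℝ}
    (hP : ∀ S, (P S).PosSemidef) (hQ : ∀ x, (Q x).PosSemidef)
    (hPQ : ∀ S x, (P S * Q x).trace ≤ t)
    (hT : Fintype.card m * (B + η) ^ (2 * T + 1) < 2 * η * (B + 2 * η) ^ (2 * T))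
    (hsmall : B * (θ + (1 / θ + 1) * (Fintype.card m * (B / η) *
      ((Fintype.card ι * T : ℕ) / Fintype.card κ) ^ (h + 1))) ≤ η) :
    -(5 * (1 + t) * η) < 𝔼 x, 𝔼 S, D (alongGraph S x) * (P S * Q x).trace := by
  classical
  obtain ⟨P', Q', hP', hQ', hPQ', hP1, hQt⟩ := exists_normalized_factorization hP hQ hPQ
  set τ : ℝ := Fintype.card m * (B / η)
  have hτ : 0 ≤ τ := by positivity
  have hlt := neg_lt_expect_trace_mul_plantedOperator hDB hD hθ hη (by linarith : 0 < 1 + t)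
    (fun S => posSemidef_truncateTrace τ (hP' S))
    (posSemidef_one_sub_expect_truncateTrace hP' hP1 τ)
    (fun S => trace_truncateTrace_le hτ (P' S)) hQ' hQt hT hsmall
  have hrare : B * (𝔼 S, if τ < (P' S).trace then (1 : ℝ) else 0) ≤ η := by
    have hm : (0 : ℝ) < Fintype.card m := by exact_mod_cast Fintype.card_pos
    have hmarkov := expect_ite_lt_trace_mul_le hP' hP1 τ
    rw [← div_le_one hη, ← mul_le_mul_iff_of_pos_left hm, mul_one]
    refine le_of_eq_of_le ?_ hmarkov
    ring
  have htruncate : 𝔼 x, (Q' x * plantedOperator D (fun S => truncateTrace τ (P' S)) x).trace ≤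
      𝔼 x, 𝔼 S, D (alongGraph S x) * (P S * Q x).trace +
        B * t * 𝔼 S, if τ < (P' S).trace then (1 : ℝ) else 0 := by
    rw [← Fintype.expect_const (ι := ι × κ → Bool) (B * t * _), ← Finset.expect_add_distrib]
    refine Finset.expect_le_expect fun x _ => ?_
    rw [trace_mul_plantedOperator, Finset.mul_expect, ← Finset.expect_add_distrib]
    refine Finset.expect_le_expect fun S _ => ?_
    rw [Matrix.trace_mul_comm, ← hPQ']
    exact mul_trace_truncateTrace_le (hP' S) (hQ' x) ((hPQ' S x).trans_le (hPQ S x)) (hDB _) τ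
  linarith [mul_le_mul_of_nonneg_right hrare ht]

end Factorization

section PlantedInstances

theorem CSPInstance.value_mem_lowDegree {k n : ℕ} {P : BoolCSP k} (I : CSPInstance P n) :
    I.value ∈ lowDegree (Fin n) k := by
  have hvalue : I.value = (1 / (I.size : ℝ)) • ∑ j, (I.constraint j).value := by
    ext x
    simp only [CSPInstance.value, Pi.smul_apply, Finset.sum_apply, smul_eq_mul]
  rw [hvalue]
  exact Submodule.smul_mem _ _ (Submodule.sum_mem _ fun j _ =>
    lowDegree_mono (Fintype.card_fin k).le
      (comp_mem_lowDegree (fun y => bitVal ((I.constraint j).pred y)) (I.constraint j).vars))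

theorem CSPInstance.value_le_opt {k n : ℕ} {P : BoolCSP k} (I : CSPInstance P n) (x : Cube n) :
    I.value x ≤ I.opt :=
  Finset.le_sup' I.value (Finset.mem_univ x)

theorem bitVal_nonneg (b : Bool) : 0 ≤ bitVal b := by
  cases b <;> norm_num [bitVal]

theorem CSPInstance.value_nonneg {k n : ℕ} {P : BoolCSP k} (I : CSPInstance P n) (x : Cube n) :
    0 ≤ I.value x :=
  mul_nonneg (by positivity) (Finset.sum_nonneg fun _ _ => bitVal_nonneg _)

/-- Rename the variables of an instance along an embedding. -/
def CSPInstance.rename {k n N : ℕ} {P : BoolCSP k} (I : CSPInstance P n) (e : Fin n ↪ Fin N) :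
    CSPInstance P N where
  size := I.size
  size_pos := I.size_pos
  constraint j := ⟨(I.constraint j).pred, (I.constraint j).pred_mem, (I.constraint j).vars.trans e⟩

theorem CSPInstance.opt_rename_le {k n N : ℕ} {P : BoolCSP k} (I : CSPInstance P n)
    (e : Fin n ↪ Fin N) : (I.rename e).opt ≤ I.opt :=
  Finset.sup'_le _ _ fun x _ => I.value_le_opt (x ∘ e)

theorem SDPRelaxation.Achieves.exists_planted_factorization {k n N r : ℕ} {P : BoolCSP k}
    {κ : Type*} {R : SDPRelaxation P N r} {c s : ℝ} (hR : R.Achieves c s) (enc : Fin n × κ ↪ Fin N)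
    {I : CSPInstance P n} (hI : I.opt ≤ s) {δ : ℝ} (hδ : 0 < δ) :
    ∃ (M : (Fin n → κ) → Matrix (Fin r) (Fin r) ℝ) (l : (Fin n → κ) → ℝ)
      (Q : (Fin n × κ → Bool) → Matrix (Fin r) (Fin r) ℝ),
      (∀ S, (M S).PosSemidef) ∧ (∀ S, 0 ≤ l S) ∧ (∀ x, (Q x).PosSemidef) ∧
        ∀ S x, |c - I.value (alongGraph S x) - ((M S * Q x).trace + l S)| ≤ δ := by
  let e : (Fin n → κ) → (Fin n ↪ Fin N) := fun S =>
    ⟨fun i => enc (i, S i), fun i j hij => (Prod.ext_iff.mp (enc.injective hij)).1⟩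
  let extend : (Fin n × κ → Bool) → Cube N := fun x => Function.extend enc x fun _ => false
  have hvalue : ∀ S x, (I.rename (e S)).value (extend x) = I.value (alongGraph S x) := fun S x =>
    congrArg I.value (funext fun i => enc.injective.extend_apply x _ (i, S i))
  choose M hM l hl hMl using fun S => R.exists_certificate
    (hR (I.rename (e S)) ((I.opt_rename_le (e S)).trans hI)) hδ
  refine ⟨M, l, fun x => R.linAssignment (extend x), hM, hl,
    fun x => R.posSemidef_assignment _, fun S x => ?_⟩
  rw [← hvalue]
  exact hMl S (extend x)

theorem expect_alongGraph_mul_le {ι κ : Type*} [Fintype ι] [Fintype κ] [DecidableEq ι]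
    [DecidableEq κ] {D f : (ι → Bool) → ℝ} {φ : (ι × κ → Bool) → ℝ} {S : ι → κ}
    {B c ε l δ : ℝ} (hDB : ∀ y, |D y| ≤ B) (hD1 : 𝔼 y, D y = 1)
    (hDf : 𝔼 y, D y * (c + ε - f y) ≤ 0) (hl : 0 ≤ l)
    (hφ : ∀ x, |c - f (alongGraph S x) - (φ x + l)| ≤ δ) :
    𝔼 x, D (alongGraph S x) * φ x ≤ B * δ - ε := by
  have hpoint : ∀ x, D (alongGraph S x) * φ x ≤
      D (alongGraph S x) * (c + ε - f (alongGraph S x)) - (ε + l) * D (alongGraph S x) +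
        B * δ := by
    intro x
    have herror : |D (alongGraph S x) * (c - f (alongGraph S x) - (φ x + l))| ≤ B * δ := by
      rw [abs_mul]
      exact mul_le_mul (hDB _) (hφ x) (abs_nonneg _) ((abs_nonneg _).trans (hDB (alongGraph S x)))
    linarith [(abs_le.mp herror).1]
  calc 𝔼 x, D (alongGraph S x) * φ x
      ≤ 𝔼 x, (D (alongGraph S x) * (c + ε - f (alongGraph S x)) -
          (ε + l) * D (alongGraph S x) + B * δ) :=
        Finset.expect_le_expect fun x _ => hpoint x
    _ = 𝔼 y, D y * (c + ε - f y) - (ε + l) + B * δ := by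
        rw [Finset.expect_add_distrib, expect_alongGraph S fun y =>
          D y * (c + ε - f y) - (ε + l) * D y, Fintype.expect_const,
          Finset.expect_sub_distrib, ← Finset.mul_expect, hD1, mul_one]
    _ ≤ B * δ - ε := by linarith

theorem SDPRelaxation.not_achieves_of_pseudoDensity {k n N r h T : ℕ} {P : BoolCSP k} {κ : Type*}
    [Fintype κ] [Nonempty κ] [NeZero r] (enc : Fin n × κ ↪ Fin N)
    (R : SDPRelaxation P N r) {c s ε B θ η : ℝ} {I : CSPInstance P n} (hI : I.opt ≤ s)
    (hε : 0 < ε) {D : Cube n → ℝ} (hB : 0 < B) (hDB : ∀ y, |D y| ≤ B)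
    (hD : IsPseudoPositive h D) (hD1 : 𝔼 y, D y = 1) (hDI : 𝔼 y, D y * (c + ε - I.value y) ≤ 0)
    (hθ : 0 < θ) (hη : 0 < η) (hηε : 10 * (2 + |c|) * η ≤ ε)
    (hT : r * (B + η) ^ (2 * T + 1) < 2 * η * (B + 2 * η) ^ (2 * T))
    (hsmall : B * (θ + (1 / θ + 1) * (r * (B / η) *
      ((n * T : ℕ) / Fintype.card κ) ^ (h + 1))) ≤ η) :
    ¬ R.Achieves c s := by
  classical
  intro hR
  set δ : ℝ := min 1 (ε / (2 * B))
  have hBδ : B * δ ≤ ε / 2 := by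
    calc B * δ ≤ B * (ε / (2 * B)) := mul_le_mul_of_nonneg_left (min_le_right _ _) hB.le
      _ = ε / 2 := by field_simp
  obtain ⟨M, l, Q, hM, hl, hQ, hMQ⟩ :=
    hR.exists_planted_factorization enc hI (lt_min one_pos (by positivity) : 0 < δ)
  have htrace : ∀ S x, (M S * Q x).trace ≤ |c| + 1 := fun S x => by
    linarith [(abs_le.mp (hMQ S x)).1, I.value_nonneg (alongGraph S x), hl S, le_abs_self c,
      min_le_left 1 (ε / (2 * B))]
  have hlower := neg_lt_expect_mul_trace (ι := Fin n) (T := T) hB hDB hD hθ hη (by positivity)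
    hM hQ htrace (by simpa only [Fintype.card_fin] using hT)
    (by simpa only [Fintype.card_fin] using hsmall)
  have hupper : 𝔼 x, 𝔼 S, D (alongGraph S x) * (M S * Q x).trace ≤ B * δ - ε := by
    rw [Finset.expect_comm]
    exact Finset.expect_le Finset.univ_nonempty fun S _ =>
      expect_alongGraph_mul_le hDB hD1 hDI (hl S) (hMQ S)
  linarith

end PlantedInstances

section Parameters

theorem two_le_one_add_one_div_pow {m : ℕ} (hm : m ≠ 0) : (2 : ℝ) ≤ (1 + 1 / m) ^ m := by
  have hbernoulli := one_add_mul_le_pow (a := (1 : ℝ) / m)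
    (le_trans (by norm_num) (by positivity : (0 : ℝ) ≤ 1 / m)) m
  rwa [mul_one_div_cancel (Nat.cast_ne_zero.mpr hm), one_add_one_eq_two] at hbernoulli

theorem pow_mul_four_pow_le {B a : ℕ} (hB : 1 ≤ B) (ha : 1 ≤ a) (L : ℕ) :
    ((B : ℝ) + 1 / a) ^ (2 * (2 * a * B * L)) * 4 ^ L ≤
      ((B : ℝ) + 2 * (1 / a)) ^ (2 * (2 * a * B * L)) := by
  set m : ℕ := 2 * a * B with hm
  have hm0 : m ≠ 0 := by positivity
  have ha' : (1 : ℝ) ≤ a := by exact_mod_cast ha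
  have hB' : (1 : ℝ) ≤ B := by exact_mod_cast hB
  have hratio : ((B : ℝ) + 1 / a) * (1 + 1 / m) ≤ B + 2 * (1 / a) := by
    have hle : (B : ℝ) + 1 / a ≤ 2 * B := by linarith [div_le_one_of_le₀ ha' (by positivity)]
    have hmul : 2 * (B : ℝ) * (1 / m) = 1 / a := by
      rw [hm]
      push_cast
      field_simp
    linarith [mul_le_mul_of_nonneg_right hle (by positivity : (0 : ℝ) ≤ 1 / m)]
  have hgrowth : (4 : ℝ) ^ L ≤ (1 + 1 / m) ^ (2 * (m * L)) := by
    calc (4 : ℝ) ^ L = 2 ^ (2 * L) := by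
          rw [pow_mul]
          norm_num
      _ ≤ ((1 + 1 / m) ^ m) ^ (2 * L) :=
        pow_le_pow_left₀ zero_le_two (two_le_one_add_one_div_pow hm0) _
      _ = (1 + 1 / m) ^ (2 * (m * L)) := by rw [← pow_mul, mul_left_comm]
  calc ((B : ℝ) + 1 / a) ^ (2 * (m * L)) * 4 ^ L
      ≤ ((B : ℝ) + 1 / a) ^ (2 * (m * L)) * (1 + 1 / m) ^ (2 * (m * L)) :=
        mul_le_mul_of_nonneg_left hgrowth (by positivity)
    _ = (((B : ℝ) + 1 / a) * (1 + 1 / m)) ^ (2 * (m * L)) := (mul_pow _ _ _).symm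
    _ ≤ (B + 2 * (1 / a)) ^ (2 * (m * L)) := pow_le_pow_left₀ (by positivity) hratio _

theorem mul_pow_succ_lt_of_lt_four_pow {r B a L : ℕ} (hB : 1 ≤ B) (ha : 1 ≤ a)
    (h : r * B * a < 4 ^ L) :
    (r : ℝ) * ((B : ℝ) + 1 / a) ^ (2 * (2 * a * B * L) + 1) <
      2 * (1 / a) * ((B : ℝ) + 2 * (1 / a)) ^ (2 * (2 * a * B * L)) := by
  have ha' : (1 : ℝ) ≤ a := by exact_mod_cast ha
  have hB' : (1 : ℝ) ≤ B := by exact_mod_cast hB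
  have hr : (r : ℝ) * (B + 1 / a) < 2 * (1 / a) * 4 ^ L := by
    calc (r : ℝ) * (B + 1 / a) ≤ r * (2 * B) := by
          gcongr
          linarith [div_le_one_of_le₀ ha' (by positivity)]
      _ = 2 * (1 / a) * (r * B * a) := by field_simp
      _ < 2 * (1 / a) * 4 ^ L := by
          gcongr
          exact_mod_cast h
  calc (r : ℝ) * (B + 1 / a) ^ (2 * (2 * a * B * L) + 1)
      = (r * (B + 1 / a)) * (B + 1 / a) ^ (2 * (2 * a * B * L)) := by ring
    _ < (2 * (1 / a) * 4 ^ L) * (B + 1 / a) ^ (2 * (2 * a * B * L)) :=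
        mul_lt_mul_of_pos_right hr (by positivity)
    _ = 2 * (1 / a) * ((B + 1 / a) ^ (2 * (2 * a * B * L)) * 4 ^ L) := by ring
    _ ≤ _ := mul_le_mul_of_nonneg_left (pow_mul_four_pow_le hB ha L) (by positivity)

theorem mul_error_le {r B η E : ℝ} (hr : 0 ≤ r) (hB : 1 ≤ B) (hη : 0 < η) (hη1 : η ≤ 1)
    (hE : 0 ≤ E) (h : 6 * B ^ 3 * r * E ≤ η ^ 3) :
    B * (η / (2 * B) + (1 / (η / (2 * B)) + 1) * (r * (B / η) * E)) ≤ η := by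
  have hone : 1 ≤ B / η := (one_le_div hη).mpr (hη1.trans hB)
  calc B * (η / (2 * B) + (1 / (η / (2 * B)) + 1) * (r * (B / η) * E))
      = η / 2 + B * ((2 * (B / η) + 1) * (r * (B / η) * E)) := by field_simp
    _ ≤ η / 2 + B * ((3 * (B / η)) * (r * (B / η) * E)) := by
        gcongr
        linarith
    _ = η / 2 + 6 * B ^ 3 * r * E / (2 * η ^ 2) := by
        field_simp
        ring
    _ ≤ η / 2 + η ^ 3 / (2 * η ^ 2) := by gcongr
    _ = η := by
        field_simp
        ring

variable {n d r a : ℕ}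

theorem succ_pow_le_pow_two_mul (hn : 2 ≤ n) (d : ℕ) : (n + 1) ^ d ≤ n ^ (2 * d) := by
  rw [pow_mul]
  exact Nat.pow_le_pow_left (by nlinarith) d

theorem mul_succ_pow_mul_lt_four_pow (hn : 2 ≤ n) (hd : 4 ≤ d) (ha : a ≤ n)
    (hr : r ≤ n ^ (d * d / 8 + 1)) : r * (n + 1) ^ d * a < 4 ^ (n * d ^ 2) := by
  have hexp : d * d / 8 + 1 + 2 * d + 1 ≤ 2 * d ^ 2 := by
    have := Nat.div_le_self (d * d) 8
    nlinarith
  calc r * (n + 1) ^ d * a ≤ n ^ (d * d / 8 + 1) * n ^ (2 * d) * n :=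
        Nat.mul_le_mul (Nat.mul_le_mul hr (succ_pow_le_pow_two_mul hn d)) ha
    _ = n ^ (d * d / 8 + 1 + 2 * d + 1) := by rw [← pow_add, ← pow_succ]
    _ ≤ n ^ (2 * d ^ 2) := Nat.pow_le_pow_right (by omega) hexp
    _ < (2 ^ n) ^ (2 * d ^ 2) := Nat.pow_lt_pow_left Nat.lt_two_pow_self (by positivity)
    _ = 4 ^ (n * d ^ 2) := by
        rw [← pow_mul, show (4 : ℕ) = 2 ^ 2 by norm_num, ← pow_mul, mul_left_comm]

theorem mul_degree_mul_pow_le (hn : 4 ≤ n) (hd : 4 ≤ d) (ha : 2 * a ≤ n) :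
    n * (2 * a * (n + 1) ^ d * (n * d ^ 2)) * n ^ (d - 4) ≤ n ^ (4 * d - 1) := by
  have hd2 : d ^ 2 ≤ n ^ d := by
    calc d ^ 2 ≤ (2 ^ d) ^ 2 := Nat.pow_le_pow_left Nat.lt_two_pow_self.le 2
      _ = 4 ^ d := by
          rw [pow_right_comm]
          norm_num
      _ ≤ n ^ d := Nat.pow_le_pow_left hn d
  have hB : (n + 1) ^ d ≤ n ^ (2 * d) := succ_pow_le_pow_two_mul (by omega) d
  calc n * (2 * a * (n + 1) ^ d * (n * d ^ 2)) * n ^ (d - 4)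
      ≤ n * (n * n ^ (2 * d) * (n * n ^ d)) * n ^ (d - 4) := by gcongr
    _ = n ^ (3 + 2 * d + d + (d - 4)) := by
        rw [pow_add, pow_add, pow_add]
        ring
    _ = n ^ (4 * d - 1) := by
        congr 1
        omega

theorem exponent_add_le (hd : 40 ≤ d) :
    4 + 6 * d + (d * d / 8 + 1) ≤ (d - 4) * (d / 2 + 1) := by
  obtain ⟨u, rfl⟩ : ∃ u, d = u + 4 := ⟨d - 4, by omega⟩
  have hdiv : 8 * ((u + 4) * (u + 4) / 8) ≤ (u + 4) * (u + 4) := Nat.mul_div_le _ _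
  have hhalf : u * (u + 5) ≤ u * (2 * ((u + 4) / 2 + 1)) := Nat.mul_le_mul_left u (by omega)
  rw [Nat.add_sub_cancel]
  nlinarith

theorem mul_succ_pow_mul_le_pow (hn : 6 ≤ n) (hd : 40 ≤ d) (ha : a ≤ n)
    (hr : r ≤ n ^ (d * d / 8 + 1)) :
    6 * a ^ 3 * ((n + 1) ^ d) ^ 3 * r ≤ (n ^ (d - 4)) ^ (d / 2 + 1) := by
  have hB : (n + 1) ^ d ≤ n ^ (2 * d) := succ_pow_le_pow_two_mul (by omega) d
  calc 6 * a ^ 3 * ((n + 1) ^ d) ^ 3 * r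
      ≤ n * n ^ 3 * (n ^ (2 * d)) ^ 3 * n ^ (d * d / 8 + 1) := by gcongr
    _ = n ^ (4 + 6 * d + (d * d / 8 + 1)) := by
        rw [pow_add, pow_add, ← pow_mul]
        ring
    _ ≤ n ^ ((d - 4) * (d / 2 + 1)) := Nat.pow_le_pow_right (by omega) (exponent_add_le hd)
    _ = (n ^ (d - 4)) ^ (d / 2 + 1) := pow_mul _ _ _

theorem mul_planting_error_le (hn : 6 ≤ n) (hd : 40 ≤ d) (ha1 : 1 ≤ a) (ha : 2 * a ≤ n)
    (hr : r ≤ n ^ (d * d / 8 + 1)) :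
    6 * (((n + 1) ^ d : ℕ) : ℝ) ^ 3 * r *
      ((n * (2 * a * (n + 1) ^ d * (n * d ^ 2)) : ℕ) / (n ^ (4 * d - 1) : ℕ)) ^ (d / 2 + 1) ≤
        (1 / (a : ℝ)) ^ 3 := by
  have : (0 : ℝ) < n := by exact_mod_cast (by omega : 0 < n)
  have : (0 : ℝ) < a := by exact_mod_cast ha1
  have hbase : ((n * (2 * a * (n + 1) ^ d * (n * d ^ 2)) : ℕ) : ℝ) / (n ^ (4 * d - 1) : ℕ) ≤
      1 / (n : ℝ) ^ (d - 4) := by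
    rw [div_le_div_iff₀ (by push_cast; positivity) (by positivity), one_mul]
    exact_mod_cast mul_degree_mul_pow_le (by omega) (by omega) ha
  have hconst : 6 * (a : ℝ) ^ 3 * (((n + 1) ^ d : ℕ) : ℝ) ^ 3 * r ≤
      ((n : ℝ) ^ (d - 4)) ^ (d / 2 + 1) := by
    exact_mod_cast mul_succ_pow_mul_le_pow hn hd (by omega) hr
  calc 6 * (((n + 1) ^ d : ℕ) : ℝ) ^ 3 * r * _ ^ (d / 2 + 1)
      ≤ 6 * (((n + 1) ^ d : ℕ) : ℝ) ^ 3 * r * (1 / (n : ℝ) ^ (d - 4)) ^ (d / 2 + 1) := by gcongr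
    _ ≤ (1 / (a : ℝ)) ^ 3 := by
        rw [div_pow, div_pow, one_pow, one_pow, mul_one_div,
          div_le_div_iff₀ (by positivity) (by positivity)]
        linarith

end Parameters

section LowerBound

theorem SDPRelaxation.not_achieves_of_le_pow {k n N r d a : ℕ} {P : BoolCSP k} {c s ε : ℝ}
    [NeZero r] (hε : 0 < ε) (hk : k ≤ 2 * (d / 2)) (hn : 6 ≤ n) (hd : 40 ≤ d) (ha1 : 1 ≤ a)
    (ha : 2 * a ≤ n) (haε : 10 * (2 + |c|) * (1 / (a : ℝ)) ≤ ε)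
    (hr : r ≤ n ^ (d * d / 8 + 1)) (hN : n ^ (4 * d) ≤ N)
    (hsos : ¬ SosAchieves P n d (c + ε) s) (R : SDPRelaxation P N r) : ¬ R.Achieves c s := by
  simp only [SosAchieves, not_forall] at hsos
  obtain ⟨I, hI, hIsos⟩ := hsos
  obtain ⟨D, hDB, hD, hD1, hDI⟩ :=
    exists_pseudoDensity (lowDegree_mono hk I.value_mem_lowDegree) hIsos
  obtain ⟨enc⟩ : Nonempty (Fin n × Fin (n ^ (4 * d - 1)) ↪ Fin N) := by
    refine Function.Embedding.nonempty_of_card_le ?_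
    rwa [Fintype.card_prod, Fintype.card_fin, Fintype.card_fin, Fintype.card_fin, ← pow_succ',
      Nat.sub_add_cancel (by omega)]
  have : NeZero (n ^ (4 * d - 1)) := ⟨by positivity⟩
  set B : ℕ := (n + 1) ^ d with hB
  have hB1 : 1 ≤ B := Nat.one_le_pow _ _ (by omega)
  refine R.not_achieves_of_pseudoDensity (T := 2 * a * B * (n * d ^ 2)) (B := B)
    (θ := 1 / a / (2 * B)) (η := 1 / a) enc hI hε (by positivity)
    (fun y => by simpa [hB] using hDB y) hD hD1 hDI (by positivity) (by positivity) haε ?_ ?_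
  · exact mul_pow_succ_lt_of_lt_four_pow hB1 ha1
      (mul_succ_pow_mul_lt_four_pow (by omega) (by omega) (by omega) hr)
  · rw [Fintype.card_fin]
    exact mul_error_le (by positivity) (by exact_mod_cast hB1) (by positivity)
      (div_le_one_of_le₀ (by exact_mod_cast ha1) (by positivity)) (by positivity)
      (mul_planting_error_le hn hd ha1 ha hr)

theorem SDPRelaxation.value_eq_zero_of_size_zero {k N : ℕ} {P : BoolCSP k}
    (R : SDPRelaxation P N 0) (J : CSPInstance P N) (x : Cube N) : J.value x = 0 := by
  rw [← R.inner_eq, frobInner, Matrix.trace_fin_zero]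

/-- The instance on `N` variables whose only constraint applies `p` to the first `k` variables. -/
def singleInstance {k N : ℕ} {P : BoolCSP k} (hkN : k ≤ N) {p : Cube k → Bool} (hp : p ∈ P) :
    CSPInstance P N :=
  ⟨1, one_pos, fun _ => ⟨p, hp, Fin.castLEEmb hkN⟩⟩

theorem singleInstance_value {k N : ℕ} {P : BoolCSP k} (hkN : k ≤ N) {p : Cube k → Bool}
    (hp : p ∈ P) (x : Cube N) :
    (singleInstance hkN hp).value x = bitVal (p (x ∘ Fin.castLEEmb hkN)) := by
  change 1 / ((1 : ℕ) : ℝ) * ∑ _ : Fin 1, bitVal (p (x ∘ Fin.castLEEmb hkN)) = _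
  simp

theorem SDPRelaxation.pred_eq_false_of_size_zero {k N : ℕ} {P : BoolCSP k}
    (R : SDPRelaxation P N 0) (hkN : k ≤ N) {p : Cube k → Bool} (hp : p ∈ P) (y : Cube k) :
    p y = false := by
  have hvalue := R.value_eq_zero_of_size_zero (singleInstance hkN hp)
    (Function.extend (Fin.castLEEmb hkN) y fun _ => false)
  rw [singleInstance_value, Function.extend_comp (Fin.castLEEmb hkN).injective] at hvalue
  simpa [bitVal] using hvalue

theorem SDPRelaxation.Achieves.sosAchieves_of_size_zero {k n N d : ℕ} {P : BoolCSP k} {c s v : ℝ}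
    {R : SDPRelaxation P N 0} (hR : R.Achieves c s) (hkN : k ≤ n → k ≤ N) (hcv : c ≤ v) :
    SosAchieves P n d v s := by
  intro I hI
  let C := I.constraint ⟨0, I.size_pos⟩
  replace hkN : k ≤ N := hkN (by simpa using Fintype.card_le_of_embedding C.vars)
  let J : CSPInstance P N := singleInstance hkN C.pred_mem
  have hJ : J.opt ≤ s := Finset.sup'_le _ _ fun x _ => by
    rw [R.value_eq_zero_of_size_zero]
    exact (I.value_nonneg fun _ => false).trans ((I.value_le_opt _).trans hI)
  have hc : 0 ≤ c := by
    have hle := R.frobInner_le (hR J hJ)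
      ⟨R.posSemidef_assignment fun _ => false, R.map_assignment fun _ => false⟩
    rwa [R.inner_eq, R.value_eq_zero_of_size_zero] at hle
  have hI0 : (fun x => v - I.value x) = v • 1 := by
    ext x
    simp [CSPInstance.value, CSPConstraint.value, bitVal,
      R.pred_eq_false_of_size_zero hkN (I.constraint _).pred_mem]
  exact sosBound_le (hI0 ▸ (isCubeSOS_one n d).smul (hc.trans hcv))

theorem le_two_mul_half_of_two_mul_ceil_le {k d : ℕ} (h : 2 * ⌈(k : ℝ) / 2⌉₊ ≤ d) :
    k ≤ 2 * (d / 2) := by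
  have hceil : k ≤ 2 * ⌈(k : ℝ) / 2⌉₊ := by
    exact_mod_cast (by linarith [Nat.le_ceil ((k : ℝ) / 2)] : (k : ℝ) ≤ 2 * ⌈(k : ℝ) / 2⌉₊)
  omega

theorem le_pow_of_natCast_le_rpow {n d r : ℕ} (hn : 1 ≤ n)
    (hr : (r : ℝ) ≤ (n : ℝ) ^ ((d : ℝ) ^ 2 / 8)) : r ≤ n ^ (d * d / 8 + 1) := by
  have hexp : (d : ℝ) ^ 2 / 8 ≤ (d * d / 8 + 1 : ℕ) := by
    rw [div_le_iff₀ (by norm_num), sq]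
    exact_mod_cast (by omega : d * d ≤ (d * d / 8 + 1) * 8)
  have hle := hr.trans (Real.rpow_le_rpow_of_exponent_le (by exact_mod_cast hn) hexp)
  rw [Real.rpow_natCast] at hle
  exact_mod_cast hle

theorem exists_pos_forall_mul_lt_one {g : ℕ → ℝ} (hg : ∀ n, 0 ≤ g n) (n₀ : ℕ) :
    ∃ K : ℝ, 0 < K ∧ K ≤ 1 ∧ ∀ n < n₀, K * g n < 1 := by
  have hsum : 0 ≤ ∑ n ∈ Finset.range n₀, g n := Finset.sum_nonneg fun n _ => hg n
  refine ⟨1 / (1 + ∑ n ∈ Finset.range n₀, g n), by positivity,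
    div_le_one_of_le₀ (by linarith) (by positivity), fun n hn => ?_⟩
  rw [one_div_mul_eq_div, div_lt_one (by positivity)]
  linarith [Finset.single_le_sum (fun n _ => hg n) (Finset.mem_range.mpr hn)]

theorem exists_nat_mul_one_div_le {C ε : ℝ} (hε : 0 < ε) :
    ∃ a : ℕ, 1 ≤ a ∧ C * (1 / (a : ℝ)) ≤ ε := by
  refine ⟨max 1 ⌈C / ε⌉₊, le_max_left _ _, ?_⟩
  have hle : C / ε ≤ (max 1 ⌈C / ε⌉₊ : ℕ) :=
    (Nat.le_ceil _).trans (by exact_mod_cast le_max_right _ _)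
  rwa [mul_one_div, div_le_comm₀ (by positivity) hε]

end LowerBound

theorem mainTheorem12_general (k : ℕ) (P : BoolCSP k) (d : ℕ → ℕ)
    (hk : ∀ n, 1 ≤ n → 2 * ⌈(k : ℝ) / 2⌉₊ ≤ d n) (hd : ∀ᶠ n in Filter.atTop, 40 ≤ d n)
    (ε s c : ℝ) (hε : 0 < ε) :
    ∃ K : ℝ, 0 < K ∧
      ∀ n : ℕ, 1 ≤ n → ¬ SosAchieves P n (d n) (c + ε) s →
        ∀ N : ℕ, n ^ (4 * d n) ≤ N →
          ∀ r : ℕ, (r : ℝ) ≤ K * (n : ℝ) ^ ((d n : ℝ) ^ 2 / 8) →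
            ∀ R : SDPRelaxation P N r, ¬ R.Achieves c s := by
  obtain ⟨a, ha, haε⟩ := exists_nat_mul_one_div_le (C := 10 * (2 + |c|)) hε
  obtain ⟨n₁, hn₁⟩ := Filter.eventually_atTop.mp
    (hd.and ((Filter.eventually_ge_atTop 6).and (Filter.eventually_ge_atTop (2 * a))))
  obtain ⟨K, hK0, hK1, hK⟩ := exists_pos_forall_mul_lt_one
    (g := fun n => (n : ℝ) ^ ((d n : ℝ) ^ 2 / 8)) (fun n => by positivity) n₁
  refine ⟨K, hK0, fun n hn hsos N hN r hr R hR => ?_⟩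
  have hkd : k ≤ 2 * (d n / 2) := le_two_mul_half_of_two_mul_ceil_le (hk n hn)
  rcases eq_zero_or_neZero r with rfl | hr0
  · refine hsos (hR.sosAchieves_of_size_zero (fun hkn => ?_) (by linarith))
    rcases Nat.eq_zero_or_pos k with rfl | hk0
    · exact N.zero_le
    · exact hkn.trans ((Nat.le_self_pow (by omega) n).trans hN)
  have hlarge : n₁ ≤ n := by
    by_contra! hsmall
    exact hr0.out (Nat.lt_one_iff.mp (by exact_mod_cast hr.trans_lt (hK n hsmall)))
  obtain ⟨hd40, hn6, hn2a⟩ := hn₁ n hlarge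
  refine R.not_achieves_of_le_pow hε hkd hn6 hd40 ha hn2a haε ?_ hN hsos hR
  exact le_pow_of_natCast_le_rpow hn (hr.trans (mul_le_of_le_one_left (by positivity) hK1))

theorem mainTheorem12 (k : ℕ) (P : BoolCSP k) (d : ℕ → ℕ)
    (hmono : MonotoneOn d (Set.Ici 1))
    (hd1 : 2 * ⌈(k : ℝ) / 2⌉₊ ≤ d 1)
    (hlim : Filter.Tendsto d Filter.atTop Filter.atTop)
    (ε s c : ℝ) (hε : 0 < ε) (hs : 0 < s) (hsc : s < c) (hc : c ≤ 1) :
    ∃ K : ℝ, 0 < K ∧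
      ∀ n : ℕ, 1 ≤ n → ¬ SosAchieves P n (d n) (c + ε) s →
        ∀ N : ℕ, n ^ (4 * d n) < N →
          ∀ r : ℕ, (r : ℝ) ≤ K * (n : ℝ) ^ ((d n : ℝ) ^ 2 / 8) →
            ∀ R : SDPRelaxation P N r, ¬ R.Achieves c s := by
  obtain ⟨K, hK, h⟩ := mainTheorem12_general k P d
    (fun n hn => hd1.trans (hmono Set.self_mem_Ici hn hn)) (hlim.eventually_ge_atTop 40) ε s c hε
  exact ⟨K, hK, fun n hn hsos N hN => h n hn hsos N hN.le⟩
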